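/- All digraphs are finite, nonempty, loopless and without parallel arcs (two opposite arcs between the same pair of vertices are allowed). A digraph is $2$-colorable if its vertices can be colored with two colors so that each color class induces an acyclic subdigraph. The treedepth of an undirected graph is at most $k$ if the graph has at most $k$ vertices, or it is disconnected and all its components have treedepth at most $k$, or deleting some vertex leaves a graph of treedepth at most $k-1$; the treedepth $\mathrm{td}$ of a digraph is that of its underlying undirected graph. The Exponential Time Hypothesis (ETH) is the statement that no algorithm decides the satisfiability of 3-SAT formulas with $n$ variables and $m$ clauses (each clause having at most three literals) in time $2^{o(n+m)}$. Algorithms are deterministic multi-tape Turing machines (given as machines with finitely many stacks), digraphs are given by their adjacency matrices, and formulas by their lists of clauses. **Theorem.** If there exists an algorithm which decides whether a given digraph on $n$ vertices and treedepth $\mathrm{td}$ is $2$-colorable in time $\mathrm{td}^{o(\mathrm{td})}\,n^{O(1)}$, then the ETH is false. That is: suppose that there are a function $f:\mathbb{N}\to\mathbb{R}$ with $f(k)=o(k)$ as $k\to\infty$, constants $C$ and $c$, and one algorithm which, on every digraph $D$ with $n$ vertices and treedepth $\mathrm{td}$, correctly decides whether $D$ is $2$-colorable in at most $C\cdot \mathrm{td}^{f(\mathrm{td})}\,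 n^{c}$ steps. Then there are a function $g:\mathbb{N}\to\mathbb{R}$ with $g(k)=o(k)$ as $k\to\infty$ and one algorithm which correctly decides the satisfiability of every 3-SAT formula with $n$ variables and $m$ clauses in at most $2^{g(n+m)}$ steps. -/

import Mathlib

open Filter Asymptotics

namespace DiColoring

/-! ### Decision problems and running time

The machine model is Mathlib's `Turing.FinTM2` (deterministic machines with finitely many stacks and
a finite control), which simulates and is simulated by multi-tape Turing machines with at most
polynomial overhead. -/

open Classical in
/-- There is one machine that, for every instance `a`, started on the string `enc a`, halts with the
correct yes/no answer to `P a` as its only output after at most `T a` steps. -/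
def DecidableWithin {α : Type} (enc : α → List Bool) (P : α → Prop) (T : α → ℝ) : Prop :=
  ∃ M : Turing.TM2ComputableAux Bool Bool, ∀ a : α, ∃ t : ℕ, (t : ℝ) ≤ T a ∧
    Nonempty (Turing.TM2OutputsInTime M.tm
      ((enc a).map M.inputAlphabet.symm)
      (some ([decide (P a)].map M.outputAlphabet.symm)) t)

/-- The self-delimiting unary code `1ᵏ0` of a natural number. -/
def unary (k : ℕ) : List Bool :=
  List.replicate k true ++ [false]

/-! ### 3-SAT and the Exponential Time Hypothesis -/

/-- A 3-CNF formula: a list of clauses, each a list of at most three literals. The literal `(x, b)`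
is the variable `x` if `b = true`, and its negation if `b = false`. -/
structure ThreeCNF where
  numVars : ℕ
  clauses : List (List (Fin numVars × Bool))
  length_le : ∀ c ∈ clauses, c.length ≤ 3

namespace ThreeCNF

/-- The number of clauses. -/
def numClauses (φ : ThreeCNF) : ℕ :=
  φ.clauses.length

/-- Some truth assignment makes at least one literal of every clause true. -/
def Satisfiable (φ : ThreeCNF) : Prop :=
  ∃ a : Fin φ.numVars → Bool, ∀ c ∈ φ.clauses, ∃ l ∈ c, a l.1 = l.2

/-- The input string of a formula: the number of variables, the number of clauses, and then, for
each clause, its length followed by its literals (a sign bit and the index of the variable). -/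
def encode (φ : ThreeCNF) : List Bool :=
  unary φ.numVars ++ unary φ.numClauses ++
    φ.clauses.flatMap fun c => unary c.length ++ c.flatMap fun l => l.2 :: unary l.1.val

end ThreeCNF

/-- The Exponential Time Hypothesis: 3-SAT on `n` variables and `m` clauses cannot be solved in
time `2 ^ o(n + m)`. -/
def ETH : Prop :=
  ¬ ∃ g : ℕ → ℝ, g =o[atTop] (fun k : ℕ => (k : ℝ)) ∧
      DecidableWithin ThreeCNF.encode ThreeCNF.Satisfiable
        (fun φ => (2 : ℝ) ^ g (φ.numVars + φ.numClauses))

/-! ### Digraph colouring -/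

/-- The subdigraph of `D` induced by a set of vertices. -/
def induce {V : Type*} (D : Digraph V) (S : Set V) : Digraph S where
  Adj u v := D.Adj u v

/-- There is no directed cycle, i.e. no closed directed walk of positive length. -/
def IsAcyclic {V : Type*} (D : Digraph V) : Prop :=
  ∀ v, ¬ Relation.TransGen D.Adj v v

/-- The vertices can be coloured with `k` colours so that every colour class induces an acyclic
subdigraph. -/
def IsColorable {V : Type*} (D : Digraph V) (k : ℕ) : Prop :=
  ∃ c : V → Fin k, ∀ i : Fin k, IsAcyclic (induce D {v | c v = i})

/-! ### Treedepth -/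

/-- `HasTreedepthLE G S k` says that the subgraph of `G` induced by `S` has treedepth at most `k`:
it has at most `k` vertices, or it is disconnected and all its components have treedepth at
most `k`, or deleting some vertex leaves a graph of treedepth at most `k - 1`. -/
inductive HasTreedepthLE {V : Type*} (G : SimpleGraph V) : Set V → ℕ → Prop
  | small (S : Set V) (k : ℕ) (h : S.encard ≤ k) : HasTreedepthLE G S k
  | components (S : Set V) (k : ℕ) (hS : ¬ (G.induce S).Preconnected)
      (h : ∀ C : (G.induce S).ConnectedComponent,
        HasTreedepthLE G (Subtype.val '' C.supp) k) : HasTreedepthLE G S k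
  | delete (S : Set V) (k : ℕ) (u : V) (hu : u ∈ S)
      (h : HasTreedepthLE G (S \ {u}) k) : HasTreedepthLE G S (k + 1)

/-- The treedepth of a (finite) graph. -/
noncomputable def treedepth {V : Type*} (G : SimpleGraph V) : ℕ :=
  sInf {k | HasTreedepthLE G Set.univ k}

/-! ### Instances of the colouring problem -/

/-- A finite nonempty loopless digraph, with vertices `0, …, n - 1`. Parallel arcs do not exist in a
`Digraph`; two opposite arcs are allowed. -/
structure DigraphInstance where
  n : ℕ
  n_pos : 0 < n
  graph : Digraph (Fin n)
  loopless : ∀ v, ¬ graph.Adj v v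

namespace DigraphInstance

open Classical in
/-- The input string of a digraph: the number of vertices, then the adjacency matrix row by row. -/
noncomputable def encode (D : DigraphInstance) : List Bool :=
  unary D.n ++ (List.finRange D.n).flatMap fun u =>
    (List.finRange D.n).map fun v => decide (D.graph.Adj u v)

/-- The treedepth of the underlying undirected graph. -/
noncomputable def td (D : DigraphInstance) : ℕ :=
  treedepth D.graph.toSimpleGraphInclusive

end DigraphInstance

end DiColoring

/-! Write N = n + m. The variables are divided into about N / q groups of q ≈ (log N) / 2 variables
each, so that an assignment on one group is a value below L = 2 ^ q = O(√N). The digraph has a small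
base, consisting of a hub, L + 1 markers and one vertex per group. To the base are attached many
gadgets of six vertices with no arcs between different gadgets. Deleting the base leaves pieces of
six vertices, so the treedepth td is at most L + 2 + G + 6 = O(N / log N), where G is the number of
groups. Hence td log td = O(N), and td ^ o(td) becomes 2 ^ o(N). The number of vertices is
polynomial in N, so the remaining factors are 2 ^ O(log N).

The hub is joined to every other base vertex by opposite arcs, so in a 2-colouring all of these have
the colour opposite to the hub's. In this acyclic class the first marker has an arc to each group
vertex, and each group vertex has an arc to the last marker. So for each group there is a value a
such that marker a reaches the group vertex and marker a + 1 does not, counting markers from 0. This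
value is read as the assignment on the group. There is a gadget for each clause and each triple of
supposed values of the groups of its variables. It is a path of six vertices, two per literal: one
with arcs group → vertex → marker a, the other with arcs marker a + 1 → vertex → group. If the
supposed value is the value read off, the first would close a cycle in the base colour and the
second would make marker a + 1 reach the group. So if all three suppositions are correct, the whole
path has the hub's colour. When the supposed values falsify the clause, the path is closed to a
cycle through the hub, so such a triple cannot be the true one and every clause is satisfied.
Conversely, for a satisfying assignment, each closed gadget has a wrong supposition, and the
corresponding vertex can be given the base colour. Both classes are then acyclic, as explicit rank
functions show. This is `Frame.isColorable_iff`; the treedepth bound is `Frame.treedepth_graph_le`.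

It remains to realize the reduction by a machine in polynomial time. Structured stack programs are
compiled to `Turing.FinTM2` and chained with the given machine
(`StackProg.decidableWithin_of_exec`). Functions computable in polynomial time on unary registers
are shown to be closed under substitution and polynomially bounded recursion (`UnaryPoly.bind`,
`UnaryPoly.recur`). The parser of formulas and the adjacency predicate are then assembled from
these. Unary registers suffice because all numbers involved are polynomial in the length of the
input. The estimates are combined in `isLittleO_maxExponent` and `time_le_two_rpow`. -/

namespace DiColoring

/-! ### A structured language for stack machines -/

/-- Structured programs acting on stacks of bits, which are indexed by natural numbers. -/
inductive StackProg
  /-- do nothing -/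
  | skip
  /-- push a bit on a stack -/
  | push (k : ℕ) (b : Bool)
  /-- sequential composition -/
  | seq (P Q : StackProg)
  /-- pop a bit and continue according to its value, or to the stack being empty -/
  | case (k : ℕ) (P Q R : StackProg)
  /-- pop bits until the stack is empty, running a program chosen by the bit after each pop -/
  | loop (k : ℕ) (P Q : StackProg)

namespace StackProg

/-- The contents of all stacks. -/
abbrev Stacks := ℕ → List Bool

/-- `Exec P s s' t`: started on the stacks `s`, the program `P` ends with the stacks `s'` after
exactly `t` machine steps. -/
inductive Exec : StackProg → Stacks → Stacks → ℕ → Prop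
  | skip (s) : Exec skip s s 1
  | push (k b s) : Exec (push k b) s (Function.update s k (b :: s k)) 1
  | seq {P Q s s' s'' t t'} (h : Exec P s s' t) (h' : Exec Q s' s'' t') :
      Exec (seq P Q) s s'' (t + t')
  | case_true {k P Q R s s' l t} (hs : s k = true :: l)
      (h : Exec P (Function.update s k l) s' t) : Exec (case k P Q R) s s' (1 + t)
  | case_false {k P Q R s s' l t} (hs : s k = false :: l)
      (h : Exec Q (Function.update s k l) s' t) : Exec (case k P Q R) s s' (1 + t)
  | case_nil {k P Q R s s' t} (hs : s k = []) (h : Exec R s s' t) :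
      Exec (case k P Q R) s s' (1 + t)
  | loop_nil {k P Q s} (hs : s k = []) : Exec (loop k P Q) s s 1
  | loop_true {k P Q s s' s'' l t t'} (hs : s k = true :: l)
      (h : Exec P (Function.update s k l) s' t) (h' : Exec (loop k P Q) s' s'' t') :
      Exec (loop k P Q) s s'' (1 + t + t')
  | loop_false {k P Q s s' s'' l t t'} (hs : s k = false :: l)
      (h : Exec Q (Function.update s k l) s' t) (h' : Exec (loop k P Q) s' s'' t') :
      Exec (loop k P Q) s s'' (1 + t + t')

/-- The control points of a program. -/
def Lab : StackProg → Type
  | skip => Unit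
  | push _ _ => Unit
  | seq P Q => Lab P ⊕ Lab Q
  | case _ P Q R => Option (Lab P ⊕ Lab Q ⊕ Lab R)
  | loop _ P Q => Option (Lab P ⊕ Lab Q)

/-- The control point at which a program starts. -/
def entry : (P : StackProg) → Lab P
  | skip => ()
  | push _ _ => ()
  | seq P _ => Sum.inl (entry P)
  | case _ _ _ _ => none
  | loop _ _ _ => none

/-- A program has finitely many control points. -/
@[reducible]
def labFintype : (P : StackProg) → Fintype (Lab P)
  | skip => inferInstanceAs (Fintype Unit)
  | push _ _ => inferInstanceAs (Fintype Unit)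
  | seq P Q =>
    letI := labFintype P
    letI := labFintype Q
    inferInstanceAs (Fintype (Lab P ⊕ Lab Q))
  | case _ P Q R =>
    letI := labFintype P
    letI := labFintype Q
    letI := labFintype R
    inferInstanceAs (Fintype (Option (Lab P ⊕ Lab Q ⊕ Lab R)))
  | loop _ P Q =>
    letI := labFintype P
    letI := labFintype Q
    inferInstanceAs (Fintype (Option (Lab P ⊕ Lab Q)))

instance (P : StackProg) : Fintype (Lab P) := labFintype P

/-- A bound on the indices of the stacks that a program uses. -/
def bound : StackProg → ℕ
  | skip => 0
  | push k _ => k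
  | seq P Q => max (bound P) (bound Q)
  | case k P Q R => max k (max (bound P) (max (bound Q) (bound R)))
  | loop k P Q => max k (max (bound P) (bound Q))

/-! ### Compilation of programs to stack machines. -/

section Compile

variable {B : ℕ} {K : Type} {Γ : K → Type} {Λ σ : Type}

/-- The alphabets of a machine with `B + 1` stacks of bits and further stacks. -/
abbrev Alph (B : ℕ) {K : Type} (Γ : K → Type) : Fin (B + 1) ⊕ K → Type
  | Sum.inl _ => Bool
  | Sum.inr k => Γ k

/-- The statements of a machine with `B + 1` stacks of bits and further stacks, which has a register
for the last bit popped. -/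
abbrev CStmt (B : ℕ) {K : Type} (Γ : K → Type) (Λ σ : Type) :=
  Turing.TM2.Stmt (Alph B Γ) Λ (Option Bool × σ)

/-- Jump to a control point, clearing the register. -/
def jump (l : Λ) : CStmt B Γ Λ σ :=
  .load (fun v => (none, v.2)) (.goto fun _ => l)

/-- Pop a bit and jump to one of three control points. -/
def popJump (k : ℕ) (l₁ l₂ l₃ : Λ) : CStmt B Γ Λ σ :=
  .pop (Sum.inl (Fin.ofNat (B + 1) k)) (fun v (o : Option Bool) => (o, v.2))
    (.branch (fun v => v.1 == some true) (jump l₁)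
      (.branch (fun v => v.1 == some false) (jump l₂) (jump l₃)))

/-- The machine statements of a program; `e` places the control points of the program among those of
the machine, and `x` is the control point to continue with. -/
def code : (P : StackProg) → (e : Lab P → Λ) → (x : Λ) → Lab P → CStmt B Γ Λ σ
  | skip, _, x, _ => jump x
  | push k b, _, x, _ => .push (Sum.inl (Fin.ofNat (B + 1) k)) (fun _ => b) (jump x)
  | seq P Q, e, x, l => match l with
    | Sum.inl l => code P (e ∘ Sum.inl) (e (Sum.inr (entry Q))) l
    | Sum.inr l => code Q (e ∘ Sum.inr) x l
  | case k P Q R, e, x, l => match l with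
    | none => popJump k (e (some (Sum.inl (entry P)))) (e (some (Sum.inr (Sum.inl (entry Q)))))
        (e (some (Sum.inr (Sum.inr (entry R)))))
    | some (Sum.inl l) => code P (e ∘ some ∘ Sum.inl) x l
    | some (Sum.inr (Sum.inl l)) => code Q (e ∘ some ∘ Sum.inr ∘ Sum.inl) x l
    | some (Sum.inr (Sum.inr l)) => code R (e ∘ some ∘ Sum.inr ∘ Sum.inr) x l
  | loop k P Q, e, x, l => match l with
    | none => popJump k (e (some (Sum.inl (entry P)))) (e (some (Sum.inr (entry Q)))) x
    | some (Sum.inl l) => code P (e ∘ some ∘ Sum.inl) (e none) l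
    | some (Sum.inr l) => code Q (e ∘ some ∘ Sum.inr) (e none) l

/-- The stacks of the machine, assembled from the stacks of the program and the further ones. -/
def join (s : Stacks) (r : ∀ k, List (Γ k)) : ∀ k, List (Alph B Γ k)
  | Sum.inl k => s k.val
  | Sum.inr k => r k

theorem join_apply {s : Stacks} {r : ∀ k, List (Γ k)} {k : ℕ} (hk : k ≤ B) :
    join (B := B) s r (Sum.inl (Fin.ofNat (B + 1) k)) = s k := by
  have hv : (Fin.ofNat (B + 1) k).val = k := Nat.mod_eq_of_lt (by omega)
  simp only [join, hv]

variable [DecidableEq K]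

/-- Running a machine for a number of steps. -/
def Runs {K : Type} [DecidableEq K] {Γ : K → Type} {Λ σ : Type}
    (m : Λ → Turing.TM2.Stmt Γ Λ σ) (t : ℕ) (c c' : Turing.TM2.Cfg Γ Λ σ) : Prop :=
  (flip Bind.bind (Turing.TM2.step m))^[t] (some c) = some c'

theorem Runs.trans {K : Type} [DecidableEq K] {Γ : K → Type} {Λ σ : Type}
    {m : Λ → Turing.TM2.Stmt Γ Λ σ} {t t' : ℕ} {c c' c'' : Turing.TM2.Cfg Γ Λ σ}
    (h : Runs m t c c') (h' : Runs m t' c' c'') : Runs m (t + t') c c'' := by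
  unfold Runs at *
  rw [Nat.add_comm, Function.iterate_add_apply, h, h']

theorem runs_one {K : Type} [DecidableEq K] {Γ : K → Type} {Λ σ : Type}
    {m : Λ → Turing.TM2.Stmt Γ Λ σ} {l : Λ} {q : Turing.TM2.Stmt Γ Λ σ} {v : σ}
    {S : ∀ k, List (Γ k)} {c' : Turing.TM2.Cfg Γ Λ σ} (hl : m l = q)
    (h : Turing.TM2.stepAux q v S = c') : Runs m 1 ⟨some l, v, S⟩ c' := by
  subst hl h
  rfl

theorem Runs.head {K : Type} [DecidableEq K] {Γ : K → Type} {Λ σ : Type}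
    {m : Λ → Turing.TM2.Stmt Γ Λ σ} {l : Λ} {v : σ} {S : ∀ k, List (Γ k)} {t : ℕ}
    {c' c'' : Turing.TM2.Cfg Γ Λ σ} (h : Turing.TM2.stepAux (m l) v S = c')
    (h' : Runs m t c' c'') : Runs m (t + 1) ⟨some l, v, S⟩ c'' := by
  subst h
  exact h'

theorem join_update {s : Stacks} {r : ∀ k, List (Γ k)} {k : ℕ} (hk : k ≤ B) (x : List Bool) :
    Function.update (join (B := B) s r) (Sum.inl (Fin.ofNat (B + 1) k)) x =
      join (Function.update s k x) r := by
  have hv : (Fin.ofNat (B + 1) k).val = k := Nat.mod_eq_of_lt (by omega)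
  funext j
  rcases j with j | j
  · by_cases hj : j = Fin.ofNat (B + 1) k
    · subst hj
      simp only [Function.update_self, join, hv]
    · rw [Function.update_of_ne (fun h => hj (Sum.inl.inj h))]
      have : j.val ≠ k := fun h => hj (Fin.ext (h.trans hv.symm))
      simp only [join, Function.update_of_ne this]
  · rw [Function.update_of_ne (by simp)]
    rfl

theorem join_update_right {s : Stacks} {r : ∀ k, List (Γ k)} {k : K} (x : List (Γ k)) :
    Function.update (join (B := B) s r) (Sum.inr k) x =
      join (B := B) s (Function.update r k x) := by
  funext j
  rcases j with j | j
  · rw [Function.update_of_ne (by simp)]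
    rfl
  · by_cases hj : j = k
    · subst hj
      simp only [Function.update_self, join]
    · rw [Function.update_of_ne (fun h => hj (Sum.inr.inj h))]
      simp only [join, Function.update_of_ne hj]

/-- Every exit goes through `jump`, which clears the register. So the register is empty at each
control point, and the statements about runs can fix it at `none`. -/
theorem stepAux_popJump {s : Stacks} {r : ∀ k, List (Γ k)} {k : ℕ} (hk : k ≤ B) (l₁ l₂ l₃ : Λ)
    (v : σ) :
    Turing.TM2.stepAux (popJump k l₁ l₂ l₃) (none, v) (join (B := B) s r) =
      ⟨some (match s k with
        | [] => l₃
        | true :: _ => l₁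
        | false :: _ => l₂), (none, v), join (Function.update s k (s k).tail) r⟩ := by
  simp only [popJump, Turing.TM2.stepAux, jump]
  rw [join_apply hk, join_update hk]
  rcases h : s k with _ | ⟨_ | _, l⟩ <;> rfl

/-- A compiled program does on the machine what the program does. -/
theorem Exec.runs {P : StackProg} {s s' : Stacks} {t : ℕ} (h : Exec P s s' t) :
    ∀ {m : Λ → CStmt B Γ Λ σ} {e : Lab P → Λ} {x : Λ}, (∀ l, m (e l) = code P e x l) →
      P.bound ≤ B → ∀ (v : σ) (r : ∀ k, List (Γ k)),
      Runs m t ⟨some (e (entry P)), (none, v), join s r⟩ ⟨some x, (none, v), join s' r⟩ := by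
  induction h with
  | skip s =>
    intro m e x hm _ v r
    exact runs_one (hm _) rfl
  | push k b s =>
    intro m e x hm hB v r
    refine runs_one (hm _) ?_
    have hB : k ≤ B := hB
    simp only [code, Turing.TM2.stepAux, jump]
    rw [join_apply hB, join_update hB]
  | seq _ _ ih ih' =>
    intro m e x hm hB v r
    rw [bound, max_le_iff] at hB
    exact (ih (e := e ∘ Sum.inl) (fun l => hm (Sum.inl l)) hB.1 v r).trans
      (ih' (e := e ∘ Sum.inr) (fun l => hm (Sum.inr l)) hB.2 v r)
  | case_true hs _ ih =>
    intro m e x hm hB v r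
    simp only [bound, max_le_iff] at hB
    refine Runs.trans (runs_one (hm none) (stepAux_popJump hB.1 _ _ _ v)) ?_
    rw [hs]
    exact ih (e := e ∘ some ∘ Sum.inl) (fun l => hm (some (Sum.inl l))) hB.2.1 v r
  | case_false hs _ ih =>
    intro m e x hm hB v r
    simp only [bound, max_le_iff] at hB
    refine Runs.trans (runs_one (hm none) (stepAux_popJump hB.1 _ _ _ v)) ?_
    rw [hs]
    exact ih (e := e ∘ some ∘ Sum.inr ∘ Sum.inl) (fun l => hm (some (Sum.inr (Sum.inl l))))
      hB.2.2.1 v r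
  | @case_nil k P Q R s s' t hs _ ih =>
    intro m e x hm hB v r
    simp only [bound, max_le_iff] at hB
    refine Runs.trans (runs_one (hm none) (stepAux_popJump hB.1 _ _ _ v)) ?_
    have : Function.update s k (s k).tail = s := by rw [hs, List.tail_nil, ← hs]; simp
    rw [this, hs]
    exact ih (e := e ∘ some ∘ Sum.inr ∘ Sum.inr) (fun l => hm (some (Sum.inr (Sum.inr l))))
      hB.2.2.2 v r
  | @loop_nil k P Q s hs =>
    intro m e x hm hB v r
    simp only [bound, max_le_iff] at hB
    refine runs_one (hm none) ((stepAux_popJump hB.1 _ _ _ v).trans ?_)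
    have : Function.update s k (s k).tail = s := by rw [hs, List.tail_nil, ← hs]; simp
    rw [this, hs]
  | loop_true hs _ _ ih ih' =>
    intro m e x hm hB v r
    have hB' := hB
    simp only [bound, max_le_iff] at hB
    refine Runs.trans (Runs.trans (runs_one (hm none) (stepAux_popJump hB.1 _ _ _ v)) ?_)
      (ih' hm hB' v r)
    rw [hs]
    exact ih (e := e ∘ some ∘ Sum.inl) (fun l => hm (some (Sum.inl l))) hB.2.1 v r
  | loop_false hs _ _ ih ih' =>
    intro m e x hm hB v r
    have hB' := hB
    simp only [bound, max_le_iff] at hB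
    refine Runs.trans (Runs.trans (runs_one (hm none) (stepAux_popJump hB.1 _ _ _ v)) ?_)
      (ih' hm hB' v r)
    rw [hs]
    exact ih (e := e ∘ some ∘ Sum.inr) (fun l => hm (some (Sum.inr l))) hB.2.2 v r

end Compile

/-! ### Running a machine after a program -/

section Compose

variable (P : StackProg) (M : Turing.TM2ComputableAux Bool Bool)

/-- The control points of a program followed by a machine. -/
abbrev ThenLab := Lab P ⊕ Unit ⊕ M.tm.Λ

/-- The statements of a machine, with `B + 1` unused stacks and an unused register. -/
def lift (B : ℕ) {K : Type} {Γ : K → Type} {Λ Λ' σ : Type} (e : Λ → Λ') :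
    Turing.TM2.Stmt Γ Λ σ → CStmt B Γ Λ' σ
  | .push k f q => .push (Sum.inr k) (fun v => f v.2) (lift B e q)
  | .peek k f q => .peek (Sum.inr k) (fun v o => (v.1, f v.2 o)) (lift B e q)
  | .pop k f q => .pop (Sum.inr k) (fun v o => (v.1, f v.2 o)) (lift B e q)
  | .load f q => .load (fun v => (v.1, f v.2)) (lift B e q)
  | .branch f q q' => .branch (fun v => f v.2) (lift B e q) (lift B e q')
  | .goto f => .goto (fun v => e (f v.2))
  | .halt => .halt

/-- The statements of a program followed by a machine. Stack `0` is the input and stack `1` the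
output of the program; the output is moved to the input of the machine. -/
def thenCode : ThenLab P M → CStmt (P.bound + 1) M.tm.Γ (ThenLab P M) M.tm.σ
  | Sum.inl l => code P Sum.inl (Sum.inr (Sum.inl ())) l
  | Sum.inr (Sum.inl ()) =>
    .pop (Sum.inl (Fin.ofNat (P.bound + 1 + 1) 1)) (fun v (o : Option Bool) => (o, v.2))
      (.branch (fun v => v.1.isSome)
        (.push (Sum.inr M.tm.k₀) (fun v => M.inputAlphabet.symm (v.1.getD false))
          (jump (Sum.inr (Sum.inl ()))))
        (jump (Sum.inr (Sum.inr M.tm.main))))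
  | Sum.inr (Sum.inr l) => lift _ (Sum.inr ∘ Sum.inr) (M.tm.m l)

/-- A program followed by a machine, as a machine. -/
def thenMachine : Turing.TM2ComputableAux Bool Bool where
  tm :=
    { K := Fin (P.bound + 1 + 1) ⊕ M.tm.K
      kDecidableEq := inferInstance
      kFin := letI := M.tm.kFin; inferInstance
      k₀ := Sum.inl 0
      k₁ := Sum.inr M.tm.k₁
      Γ := Alph (P.bound + 1) M.tm.Γ
      Λ := ThenLab P M
      main := Sum.inl (entry P)
      ΛFin := letI := M.tm.ΛFin; inferInstance
      σ := Option Bool × M.tm.σ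
      initialState := (none, M.tm.initialState)
      σFin := letI := M.tm.σFin; inferInstance
      Γk₀Fin := inferInstanceAs (Fintype Bool)
      m := thenCode P M }
  inputAlphabet := Equiv.refl Bool
  outputAlphabet := M.outputAlphabet

/-- The stacks with a single nonempty one. -/
def single (k : ℕ) (l : List Bool) : Stacks := Function.update (fun _ => []) k l

/-- The lifted statements touch neither the additional stacks nor the additional register, so a step
commutes with the embedding of configurations. -/
theorem stepAux_lift {B : ℕ} {K : Type} [DecidableEq K] {Γ : K → Type} {Λ Λ' σ : Type}
    (e : Λ → Λ') (q : Turing.TM2.Stmt Γ Λ σ) (b : Option Bool) (v : σ) (s : Stacks)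
    (r : ∀ k, List (Γ k)) :
    Turing.TM2.stepAux (lift B e q) (b, v) (join (B := B) s r) =
      ⟨(Turing.TM2.stepAux q v r).l.map e, (b, (Turing.TM2.stepAux q v r).var),
        join (B := B) s (Turing.TM2.stepAux q v r).stk⟩ := by
  induction q generalizing v r with
  | push k f q ih =>
    simp only [lift, Turing.TM2.stepAux]
    rw [join_update_right, ih]
    simp only [join]
  | peek k f q ih =>
    simp only [lift, Turing.TM2.stepAux]
    rw [ih]
    simp only [join]
  | pop k f q ih =>
    simp only [lift, Turing.TM2.stepAux]
    rw [join_update_right, ih]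
    simp only [join]
  | load f q ih =>
    simp only [lift, Turing.TM2.stepAux]
    exact ih _ _
  | branch f q q' ih ih' =>
    simp only [lift, Turing.TM2.stepAux]
    cases f v
    · exact ih' _ _
    · exact ih _ _
  | goto f => rfl
  | halt => rfl

theorem runs_lift {t : ℕ} {c c' : M.tm.Cfg}
    (h : (flip Bind.bind M.tm.step)^[t] (some c) = some c') (s : Stacks) :
    Runs (thenCode P M) t
      ⟨c.l.map (Sum.inr ∘ Sum.inr), (none, c.var), join (B := P.bound + 1) s c.stk⟩
      ⟨c'.l.map (Sum.inr ∘ Sum.inr), (none, c'.var), join (B := P.bound + 1) s c'.stk⟩ := by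
  induction t generalizing c with
  | zero =>
    cases h
    rfl
  | succ t ih =>
    rw [Function.iterate_succ_apply] at h
    rcases c with ⟨_ | l, v, r⟩
    -- A halted configuration has no successor, so it cannot start a run of positive length.
    · exfalso
      have hn : ∀ t, (flip Bind.bind M.tm.step)^[t] none = none := by
        intro t
        induction t with
        | zero => rfl
        | succ t ih => rw [Function.iterate_succ_apply]; exact ih
      have : (flip Bind.bind M.tm.step)^[t] none = some c' := h
      rw [hn] at this
      exact absurd this (by simp)
    · have h2 := ih (c := Turing.TM2.stepAux (M.tm.m l) v r) h
      exact Runs.head (stepAux_lift _ _ _ _ _ _) h2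

/-- Popping one stack and pushing on the other reverses the order, which is why programs are asked
to leave their output reversed. The last of the `l.length + 1` steps finds the stack empty and
starts the machine. -/
theorem runs_transfer (l : List Bool) (r : List (M.tm.Γ M.tm.k₀)) (v : M.tm.σ) :
    Runs (thenCode P M) (l.length + 1)
      ⟨some (Sum.inr (Sum.inl ())), (none, v), join (B := P.bound + 1) (single 1 l)
        (Function.update (fun _ => []) M.tm.k₀ r)⟩
      ⟨some (Sum.inr (Sum.inr M.tm.main)), (none, v), join (B := P.bound + 1) (fun _ => [])
        (Function.update (fun _ => []) M.tm.k₀ (l.reverse.map M.inputAlphabet.symm ++ r))⟩ := by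
  have h1 : 1 ≤ P.bound + 1 := by omega
  have hu : ∀ l l', Function.update (single 1 l) 1 l' = single 1 l' := by
    intro l l'
    simp only [single, Function.update_idem]
  induction l generalizing r with
  | nil =>
    refine runs_one rfl ?_
    have h0 : single 1 [] = fun _ => [] :=
      Function.update_eq_self (f := fun _ : ℕ => ([] : List Bool)) 1
    simp only [thenCode, Turing.TM2.stepAux]
    rw [join_apply h1, join_update h1, hu]
    simp only [single, Function.update_self, List.tail_nil, jump, Turing.TM2.stepAux]
    rw [← single, h0]
    rfl
  | cons b l ih =>
    refine Runs.head ?_ ?_ (c' := ⟨some (Sum.inr (Sum.inl ())), (none, v), join (single 1 l)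
        (Function.update (fun _ => []) M.tm.k₀ (M.inputAlphabet.symm b :: r))⟩)
    · simp only [thenCode, Turing.TM2.stepAux]
      rw [join_apply h1, join_update h1, hu, join_update_right]
      simp only [single, Function.update_self, List.tail_cons, jump, Turing.TM2.stepAux]
      simp only [List.head?_cons, Option.isSome_some, cond_true, join, Function.update_self,
        Function.update_idem, Option.getD_some]
    · have := ih (M.inputAlphabet.symm b :: r)
      rwa [List.reverse_cons, List.map_append, List.append_assoc]

/-- Deciding a problem by reducing it to another one with a program. -/
theorem decidableWithin_of_exec {α β : Type} {enc : α → List Bool} {enc' : β → List Bool}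
    {Q : α → Prop} {Q' : β → Prop} {T' : β → ℝ} (r : α → β) (hr : ∀ a, Q a ↔ Q' (r a))
    (P : StackProg) (T : α → ℕ)
    (hP : ∀ a, ∃ t ≤ T a, Exec P (single 0 (enc a)) (single 1 (enc' (r a)).reverse) t)
    (h : DecidableWithin enc' Q' T') :
    DecidableWithin enc Q (fun a => T a + ((enc' (r a)).length + 1) + T' (r a)) := by
  obtain ⟨M, hM⟩ := h
  refine ⟨thenMachine P M, fun a => ?_⟩
  obtain ⟨t, ht, hex⟩ := hP a
  obtain ⟨t', ht', ⟨⟨⟨n, hn⟩, hnt⟩⟩⟩ := hM (r a)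
  refine ⟨t + ((enc' (r a)).reverse.length + 1) + n, ?_, ⟨⟨⟨_, ?_⟩, le_rfl⟩⟩⟩
  · push_cast [List.length_reverse]
    have h1 : (t : ℝ) ≤ T a := by exact_mod_cast ht
    have h2 : (n : ℝ) ≤ t' := by exact_mod_cast hnt
    linarith
  · classical
    have hd : decide (Q a) = decide (Q' (r a)) := decide_eq_decide.mpr (hr a)
    have hu : ∀ x, Function.update (fun _ => []) M.tm.k₀ x = (Turing.initList M.tm x).stk := by
      intro x
      funext k
      by_cases hk : k = M.tm.k₀
      · subst hk
        simp [Turing.initList]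
      · simp [Turing.initList, hk]
    have h1 := hex.runs (m := thenCode P M) (e := Sum.inl) (x := Sum.inr (Sum.inl ()))
      (fun l => rfl) (by omega : P.bound ≤ P.bound + 1) M.tm.initialState (fun _ => [])
    have h2 := runs_transfer P M (enc' (r a)).reverse [] M.tm.initialState
    rw [List.reverse_reverse, List.append_nil,
      Function.update_eq_self (f := fun k => ([] : List (M.tm.Γ k))), hu] at h2
    have h3 := runs_lift P M hn (fun _ => [])
    have h4 := (h1.trans h2).trans h3
    unfold Runs at h4
    refine (congrArg (fun c => (flip Bind.bind (thenMachine P M).tm.step)^[_] (some c)) ?_).trans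
      (h4.trans (congrArg some ?_))
    · change Turing.TM2.Cfg.mk _ _ _ = _
      congr 1
      funext k
      rcases k with k | k
      · by_cases hk : k = 0
        · subst hk
          simp [join, single, thenMachine]
          exact List.map_id _
        · have : ¬ k.val = 0 := fun h => hk (Fin.ext h)
          simp [join, single, thenMachine, hk, this]
      · simp [join, thenMachine]
    · change _ = Turing.TM2.Cfg.mk _ _ _
      simp only [Turing.haltList]
      congr 1
      funext k
      rcases k with k | k
      · simp [join, thenMachine]
      · by_cases hk : k = M.tm.k₁
        · subst hk
          simp [join, thenMachine, hd]
          rfl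
        · simp [join, thenMachine, hk]

end Compose

end StackProg
end DiColoring

namespace DiColoring
namespace StackProg

/-! ### Basic programs on unary registers -/

theorem Exec.congr {P : StackProg} {s s' s'' : Stacks} {t : ℕ} (h : Exec P s s' t)
    (hs : s' = s'') : Exec P s s'' t := hs ▸ h

/-- A loop controlled by a unary counter. -/
theorem exec_loop_unary {c n τ : ℕ} {P Q : StackProg} (S : ℕ → Stacks)
    (hc : ∀ i ≤ n, S i c = List.replicate (n - i) true)
    (hP : ∀ i < n, ∃ t ≤ τ,
      Exec P (Function.update (S i) c (List.replicate (n - (i + 1)) true)) (S (i + 1)) t) :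
    ∃ t ≤ n * (τ + 1) + 1, Exec (loop c P Q) (S 0) (S n) t := by
  -- Induction on the number `j` of rounds left, with the current round `i` varying.
  suffices h : ∀ j i, i + j = n → ∃ t ≤ j * (τ + 1) + 1, Exec (loop c P Q) (S i) (S n) t from
    h n 0 (by omega)
  intro j
  induction j with
  | zero =>
    intro i hi
    obtain rfl : i = n := by omega
    exact ⟨1, by omega, Exec.loop_nil (by rw [hc i le_rfl, Nat.sub_self]; rfl)⟩
  | succ j ih =>
    intro i hi
    obtain ⟨t, ht, h⟩ := hP i (by omega)
    obtain ⟨t', ht', h'⟩ := ih (i + 1) (by omega)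
    refine ⟨1 + t + t', by rw [Nat.add_mul]; omega, Exec.loop_true ?_ h h'⟩
    rw [hc i (by omega), ← List.replicate_succ]
    congr 1
    omega

/-- Empty a stack. -/
def clear (k : ℕ) : StackProg := loop k skip skip

theorem exec_clear (k : ℕ) (s : Stacks) :
    Exec (clear k) s (Function.update s k []) (2 * (s k).length + 1) := by
  generalize hl : s k = l
  induction l generalizing s with
  | nil =>
    refine (Exec.loop_nil hl).congr ?_
    rw [← hl, Function.update_eq_self]
  | cons b l ih =>
    have h := ih (Function.update s k l) (by simp)
    rw [Function.update_idem] at h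
    have ht : 2 * (b :: l).length + 1 = 1 + 1 + (2 * l.length + 1) := by
      rw [List.length_cons]; omega
    rw [ht]
    cases b
    · exact Exec.loop_false hl (Exec.skip _) h
    · exact Exec.loop_true hl (Exec.skip _) h

/-- Move the bits of a stack to another one, reversing their order. -/
def move (k d : ℕ) : StackProg := loop k (push d true) (push d false)

theorem exec_move {k d : ℕ} (hkd : k ≠ d) (s : Stacks) :
    Exec (move k d) s (Function.update (Function.update s k []) d ((s k).reverse ++ s d))
      (2 * (s k).length + 1) := by
  generalize hl : s k = l
  induction l generalizing s with
  | nil =>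
    refine (Exec.loop_nil hl).congr ?_
    have : Function.update s k [] = s := by rw [← hl, Function.update_eq_self]
    rw [this, List.reverse_nil, List.nil_append, Function.update_eq_self]
  | cons b l ih =>
    have h := ih (Function.update (Function.update s k l) d (b :: s d))
      (by rw [Function.update_of_ne hkd, Function.update_self])
    have ht : 2 * (b :: l).length + 1 = 1 + 1 + (2 * l.length + 1) := by
      rw [List.length_cons]; omega
    have he : Function.update (Function.update (Function.update (Function.update s k l) d (b :: s d))
        k []) d (l.reverse ++ (Function.update (Function.update s k l) d (b :: s d)) d) =
        Function.update (Function.update s k []) d ((b :: l).reverse ++ s d) := by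
      rw [Function.update_comm hkd.symm, Function.update_idem, Function.update_idem,
        Function.update_self]
      simp
    rw [ht, ← he]
    have hd : Function.update s k l d = s d := Function.update_of_ne hkd.symm _ _
    cases b
    · refine Exec.loop_false hl ?_ h
      rw [← hd]
      exact Exec.push _ _ _
    · refine Exec.loop_true hl ?_ h
      rw [← hd]
      exact Exec.push _ _ _

theorem exec_move_unary {k d m n : ℕ} (hkd : k ≠ d) {s : Stacks}
    (hk : s k = List.replicate m true) (hd : s d = List.replicate n true) :
    Exec (move k d) s (Function.update (Function.update s k []) d (List.replicate (m + n) true))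
      (2 * m + 1) := by
  have h := exec_move hkd s
  rwa [hk, hd, List.reverse_replicate, List.replicate_append_replicate, List.length_replicate] at h

/-- Copy a unary register, using an empty register. -/
def copy (k d e : ℕ) : StackProg :=
  seq (loop k (seq (push d true) (push e true)) skip) (move e k)

theorem exec_copy {k d e n : ℕ} (hkd : k ≠ d) (hke : k ≠ e) (hde : d ≠ e) {s : Stacks}
    (hk : s k = List.replicate n true) (hd : s d = []) (he : s e = []) :
    ∃ t ≤ 5 * n + 2, Exec (copy k d e) s (Function.update s d (List.replicate n true)) t := by
  -- The loop consumes `k` while filling both `d` and `e`; then `e` is moved back to `k`. The costs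
  -- are `3 * n + 1` and `2 * n + 1`.
  obtain ⟨t, ht, h⟩ := exec_loop_unary (c := k) (n := n) (τ := 2) (P := seq (push d true) (push e true))
    (Q := skip) (fun i => Function.update (Function.update (Function.update s k
      (List.replicate (n - i) true)) d (List.replicate i true)) e (List.replicate i true))
    (fun i _ => by simp [hkd, hke])
    (fun i _ => by
      refine ⟨1 + 1, le_rfl, (Exec.seq (Exec.push _ _ _) (Exec.push _ _ _)).congr ?_⟩
      funext j
      simp only [Function.update_apply]
      split_ifs <;> simp_all [List.replicate_succ])
  have h2 := exec_move_unary (s := Function.update (Function.update (Function.update s k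
      (List.replicate (n - n) true)) d (List.replicate n true)) e (List.replicate n true))
    (k := e) (d := k) (m := n) (n := 0) hke.symm (by simp)
    (by simp [hkd, hke])
  refine ⟨t + (2 * n + 1), by omega, ?_⟩
  have h0 : (Function.update (Function.update (Function.update s k (List.replicate (n - 0) true)) d
      (List.replicate 0 true)) e (List.replicate 0 true)) = s := by
    funext j
    simp only [Function.update_apply]
    split_ifs <;> simp_all
  rw [h0] at h
  refine (Exec.seq h h2).congr ?_
  funext j
  simp only [Function.update_apply]
  split_ifs <;> simp_all

end StackProg

/-! ### Polynomially bounded functions -/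

/-- The size of an input string with number arguments. -/
def size (w : List Bool) {k : ℕ} (x : Fin k → ℕ) : ℕ := w.length + ∑ i, x i + 2

/-- A function that is bounded by a polynomial in the size of its arguments. -/
def PolyBdd {k : ℕ} (F : List Bool → (Fin k → ℕ) → ℕ) : Prop :=
  ∃ c, ∀ w x, F w x ≤ size w x ^ c

namespace PolyBdd

variable {k : ℕ} {F G : List Bool → (Fin k → ℕ) → ℕ}

/-- The summand `2` in `size` keeps the base at least `2`, so that constants and sums can be
absorbed by a larger exponent. -/
theorem two_le_size (w : List Bool) (x : Fin k → ℕ) : 2 ≤ size w x := by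
  unfold size; omega

theorem mono (hG : PolyBdd G) (h : ∀ w x, F w x ≤ G w x) : PolyBdd F := by
  obtain ⟨c, hc⟩ := hG
  exact ⟨c, fun w x => (h w x).trans (hc w x)⟩

theorem size : PolyBdd (fun w (x : Fin k → ℕ) => size w x) :=
  ⟨1, fun w x => by rw [pow_one]⟩

theorem const (n : ℕ) : PolyBdd (fun _ (_ : Fin k → ℕ) => n) :=
  ⟨n, fun w x => (Nat.lt_two_pow_self).le.trans (Nat.pow_le_pow_left (two_le_size w x) n)⟩

theorem arg (i : Fin k) : PolyBdd (fun _ x => x i) :=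
  size.mono fun w x => by
    have := Finset.single_le_sum (f := x) (fun _ _ => Nat.zero_le _) (Finset.mem_univ i)
    unfold DiColoring.size
    omega

theorem length : PolyBdd (fun w (_ : Fin k → ℕ) => w.length) :=
  size.mono fun w x => by unfold DiColoring.size; omega

theorem mul (hF : PolyBdd F) (hG : PolyBdd G) : PolyBdd (fun w x => F w x * G w x) := by
  obtain ⟨c, hc⟩ := hF
  obtain ⟨d, hd⟩ := hG
  exact ⟨c + d, fun w x => by rw [pow_add]; exact Nat.mul_le_mul (hc w x) (hd w x)⟩

theorem add (hF : PolyBdd F) (hG : PolyBdd G) : PolyBdd (fun w x => F w x + G w x) := by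
  obtain ⟨c, hc⟩ := hF
  obtain ⟨d, hd⟩ := hG
  refine ⟨c + d + 1, fun w x => ?_⟩
  have h2 := two_le_size w x
  have h3 : DiColoring.size w x ^ c ≤ DiColoring.size w x ^ (c + d) :=
    Nat.pow_le_pow_right (by omega) (by omega)
  have h4 : DiColoring.size w x ^ d ≤ DiColoring.size w x ^ (c + d) :=
    Nat.pow_le_pow_right (by omega) (by omega)
  rw [pow_succ]
  nlinarith [hc w x, hd w x]

theorem pow (hF : PolyBdd F) (n : ℕ) : PolyBdd (fun w x => F w x ^ n) := by
  obtain ⟨c, hc⟩ := hF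
  exact ⟨c * n, fun w x => by rw [pow_mul]; exact Nat.pow_le_pow_left (hc w x) n⟩

/-- Substituting polynomially bounded functions for the arguments. -/
theorem comp {m : ℕ} {H : List Bool → (Fin m → ℕ) → ℕ} (hH : PolyBdd H)
    {g : Fin m → List Bool → (Fin k → ℕ) → ℕ} (hg : ∀ i, PolyBdd (g i)) :
    PolyBdd (fun w x => H w (fun i => g i w x)) := by
  obtain ⟨c, hc⟩ := hH
  have hs : ∀ s : Finset (Fin m), PolyBdd (fun w x => ∑ i ∈ s, g i w x) := by
    intro s
    induction s using Finset.induction_on with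
    | empty => simpa using const 0
    | insert i s hi ih =>
      simp only [Finset.sum_insert hi]
      exact (hg i).add ih
  exact (((length.add (hs Finset.univ)).add (const 2)).pow c).mono fun w x => hc w _

end PolyBdd
end DiColoring

namespace DiColoring

open StackProg

/-! ### Functions computable in polynomial time on unary registers -/

/-- The stacks `s` meet the calling convention: the input is on stack `0`, the arguments are in the
registers `a`, the register `d` for the result and those from `b` on are empty. -/
structure Ready {k : ℕ} (w : List Bool) (x : Fin k → ℕ) (a : Fin k → ℕ) (d b : ℕ)
    (s : Stacks) : Prop where
  two_le : 2 ≤ d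
  lt : d < b
  two_le_arg : ∀ i, 2 ≤ a i
  arg_lt : ∀ i, a i < b
  arg_ne : ∀ i, a i ≠ d
  input : s 0 = w
  arg : ∀ i, s (a i) = List.replicate (x i) true
  dest : s d = []
  free : ∀ j, b ≤ j → s j = []

/-- A program, depending on the registers to be used, that computes a function of the input string
and unary arguments within a given time. -/
def Computes {k : ℕ} (P : (Fin k → ℕ) → ℕ → ℕ → StackProg)
    (f T : List Bool → (Fin k → ℕ) → ℕ) : Prop :=
  ∀ w x a d b s, Ready w x a d b s → ∃ t ≤ T w x,
    Exec (P a d b) s (Function.update s d (List.replicate (f w x) true)) t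

/-- The function can be computed in polynomial time on unary registers. -/
def UnaryPoly {k : ℕ} (f : List Bool → (Fin k → ℕ) → ℕ) : Prop :=
  PolyBdd f ∧ ∃ P T, PolyBdd T ∧ Computes P f T

namespace UnaryPoly

variable {k : ℕ} {f g : List Bool → (Fin k → ℕ) → ℕ}

theorem zero : UnaryPoly (fun _ (_ : Fin k → ℕ) => 0) := by
  refine ⟨PolyBdd.const 0, fun _ _ _ => skip, fun _ _ => 1, PolyBdd.const 1, ?_⟩
  intro w x a d b s h
  refine ⟨1, le_rfl, (Exec.skip s).congr ?_⟩
  rw [List.replicate_zero, ← h.dest, Function.update_eq_self]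

theorem arg (i : Fin k) : UnaryPoly (fun _ x => x i) := by
  refine ⟨PolyBdd.arg i, fun a d b => copy (a i) d b, fun _ x => 5 * x i + 2,
    ((PolyBdd.const 5).mul (PolyBdd.arg i)).add (PolyBdd.const 2), ?_⟩
  intro w x a d b s h
  exact exec_copy (h.arg_ne i) (h.arg_lt i).ne h.lt.ne (h.arg i) h.dest (h.free b le_rfl)

theorem succ (hf : UnaryPoly f) : UnaryPoly (fun w x => f w x + 1) := by
  obtain ⟨hb, P, T, hT, hP⟩ := hf
  refine ⟨hb.add (PolyBdd.const 1), fun a d b => seq (P a d b) (push d true), fun w x => T w x + 1,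
    hT.add (PolyBdd.const 1), ?_⟩
  intro w x a d b s h
  obtain ⟨t, ht, he⟩ := hP w x a d b s h
  refine ⟨t + 1, Nat.succ_le_succ ht, (Exec.seq he (Exec.push _ _ _)).congr ?_⟩
  rw [Function.update_idem, Function.update_self, List.replicate_succ]

theorem const (n : ℕ) : UnaryPoly (fun _ (_ : Fin k → ℕ) => n) := by
  induction n with
  | zero => exact zero
  | succ n ih => exact ih.succ

/-- Renaming the arguments. -/
theorem rename {m : ℕ} (hf : UnaryPoly f) (σ : Fin k → Fin m) :
    UnaryPoly (fun w (x : Fin m → ℕ) => f w (fun i => x (σ i))) := by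
  obtain ⟨hb, P, T, hT, hP⟩ := hf
  refine ⟨hb.comp fun i => PolyBdd.arg (σ i), fun a d b => P (fun i => a (σ i)) d b,
    fun w x => T w (fun i => x (σ i)), hT.comp fun i => PolyBdd.arg (σ i), ?_⟩
  intro w x a d b s h
  exact hP w _ _ d b s ⟨h.two_le, h.lt, fun i => h.two_le_arg _, fun i => h.arg_lt _,
    fun i => h.arg_ne _, h.input, fun i => h.arg _, h.dest, h.free⟩

theorem _root_.DiColoring.PolyBdd.cons {F : List Bool → (Fin (k + 1) → ℕ) → ℕ} (hF : PolyBdd F)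
    (hg : PolyBdd g) : PolyBdd (fun w x => F w (Fin.cons (g w x) x)) := by
  have h := hF.comp (g := Fin.cases g (fun i _ x => x i))
    (fun i => by cases i using Fin.cases with
      | zero => exact hg
      | succ i => exact PolyBdd.arg i)
  refine h.mono fun w x => ?_
  refine le_of_eq ?_
  congr 1
  funext i
  cases i using Fin.cases <;> rfl

/-- Using the value of a function as a further argument. -/
theorem bind {F : List Bool → (Fin (k + 1) → ℕ) → ℕ} (hF : UnaryPoly F) (hg : UnaryPoly g) :
    UnaryPoly (fun w x => F w (Fin.cons (g w x) x)) := by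
  obtain ⟨hFb, P, T, hT, hP⟩ := hF
  obtain ⟨hgb, P', T', hT', hP'⟩ := hg
  refine ⟨hFb.cons hgb,
    -- Register `b`, the first free one, holds the intermediate value and is passed as argument `0`.
    -- It is cleared at the end to restore the calling convention.
    fun a d b => seq (P' a b (b + 1)) (seq (P (Fin.cons b a) d (b + 1)) (clear b)),
    fun w x => T' w x + (T w (Fin.cons (g w x) x) + (2 * g w x + 1)),
    hT'.add ((hT.cons hgb).add (((PolyBdd.const 2).mul hgb).add (PolyBdd.const 1))), ?_⟩
  intro w x a d b s h
  have hlt := h.lt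
  have h2 := h.two_le
  obtain ⟨t, ht, he⟩ := hP' w x a b (b + 1) s ⟨by omega, by omega, h.two_le_arg,
    fun i => (h.arg_lt i).trans (Nat.lt_succ_self b), fun i => (h.arg_lt i).ne, h.input, h.arg,
    h.free b le_rfl, fun j hj => h.free j (by omega)⟩
  set s₁ := Function.update s b (List.replicate (g w x) true) with hs₁
  have h₁ : ∀ j, j ≠ b → s₁ j = s j := fun j hj => Function.update_of_ne hj _ _
  obtain ⟨t', ht', he'⟩ := hP w (Fin.cons (g w x) x) (Fin.cons b a) d (b + 1) s₁ ⟨h2, by omega,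
    fun i => by
      cases i using Fin.cases with
      | zero => exact h2.trans hlt.le
      | succ i => exact h.two_le_arg i,
    fun i => by
      cases i using Fin.cases with
      | zero => exact Nat.lt_succ_self b
      | succ i => exact (h.arg_lt i).trans (Nat.lt_succ_self b),
    fun i => by
      cases i using Fin.cases with
      | zero => exact hlt.ne'
      | succ i => exact h.arg_ne i,
    by rw [h₁ 0 (by omega), h.input],
    fun i => by
      cases i using Fin.cases with
      | zero => exact Function.update_self _ _ _
      | succ i => exact (h₁ _ (h.arg_lt i).ne).trans (h.arg i),
    by rw [h₁ d hlt.ne, h.dest],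
    fun j hj => by rw [h₁ j (by omega), h.free j (by omega)]⟩
  have he'' := exec_clear b (Function.update s₁ d (List.replicate (F w (Fin.cons (g w x) x)) true))
  rw [Function.update_of_ne hlt.ne', hs₁, Function.update_self, List.length_replicate] at he''
  refine ⟨_, ?_, (Exec.seq he (Exec.seq he' he'')).congr ?_⟩
  · beta_reduce
    omega
  · have hb := h.free b le_rfl
    funext j
    by_cases hj : j = b
    · subst hj
      simp [hb, hlt.ne']
    · simp [Function.update_apply, hj]

theorem congr (hf : UnaryPoly f) (h : ∀ w x, f w x = g w x) : UnaryPoly g := by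
  have : f = g := funext fun w => funext fun x => h w x
  rwa [← this]

/-- Substitution in a function of one argument. -/
theorem comp₁ {F : List Bool → (Fin 1 → ℕ) → ℕ} (hF : UnaryPoly F) (hf : UnaryPoly f) :
    UnaryPoly (fun w x => F w ![f w x]) := by
  refine ((hF.rename (m := k + 1) ![0]).bind hf).congr fun w x => ?_
  congr 1
  funext i
  fin_cases i
  rfl

/-- Bounded recursion. -/
theorem recur {n B : List Bool → (Fin k → ℕ) → ℕ} {F : List Bool → (Fin k → ℕ) → ℕ → ℕ}
    {G : List Bool → (Fin (k + 2) → ℕ) → ℕ} (hn : UnaryPoly n)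
    (h0 : UnaryPoly (fun w x => F w x 0)) (hG : UnaryPoly G)
    (hF : ∀ w x i, i < n w x → F w x (i + 1) = G w (Fin.cons i (Fin.cons (F w x i) x)))
    (hB : PolyBdd B) (hFB : ∀ w x i, i ≤ n w x → F w x i ≤ B w x) :
    UnaryPoly (fun w x => F w x (n w x)) := by
  obtain ⟨hnb, Pn, Tn, hTn, hPn⟩ := hn
  obtain ⟨h0b, P0, T0, hT0, hP0⟩ := h0
  obtain ⟨hGb, PG, TG, hTG, hPG⟩ := hG
  obtain ⟨c, hc⟩ := hTG
  -- A bound for one round: the time of `G` on an index at most `n` and a value at most `B`, then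
  -- clearing the old value, moving the new one and increasing the index. The bound `B` is
  -- essential, since iterated values could otherwise grow exponentially.
  set τ : List Bool → (Fin k → ℕ) → ℕ := fun w x =>
    (w.length + (n w x + (B w x + ∑ i, x i)) + 2) ^ c + ((2 * B w x + 1) + ((2 * B w x + 1) + 1))
    with hτ
  have hsum : PolyBdd (fun _ (x : Fin k → ℕ) => ∑ i, x i) :=
    PolyBdd.size.mono fun w x => by unfold DiColoring.size; omega
  have hτb : PolyBdd τ := by
    have h2B := ((PolyBdd.const 2).mul hB).add (PolyBdd.const 1)
    exact (((PolyBdd.length.add (hnb.add (hB.add hsum))).add (PolyBdd.const 2)).pow c).add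
      (h2B.add (h2B.add (PolyBdd.const 1)))
  refine ⟨hB.mono fun w x => hFB w x _ le_rfl,
    -- Register `b` counts the rounds down, `b + 1` holds the index, `b + 2` the current value and
    -- `b + 3` the next value.
    fun a d b => seq (Pn a b (b + 1)) (seq (P0 a (b + 2) (b + 3)) (seq
      (loop b (seq (PG (Fin.cons (b + 1) (Fin.cons (b + 2) a)) (b + 3) (b + 4))
        (seq (clear (b + 2)) (seq (move (b + 3) (b + 2)) (push (b + 1) true)))) skip)
      (seq (move (b + 2) d) (clear (b + 1))))),
    fun w x => Tn w x + (T0 w x + ((n w x * (τ w x + 1) + 1) +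
      ((2 * B w x + 1) + (2 * n w x + 1)))), ?_, ?_⟩
  · exact hTn.add (hT0.add (((hnb.mul (hτb.add (PolyBdd.const 1))).add (PolyBdd.const 1)).add
      ((((PolyBdd.const 2).mul hB).add (PolyBdd.const 1)).add
        (((PolyBdd.const 2).mul hnb).add (PolyBdd.const 1)))))
  intro w x a d b s h
  have hlt := h.lt
  have h2 := h.two_le
  obtain ⟨t₁, ht₁, he₁⟩ := hPn w x a b (b + 1) s ⟨by omega, by omega, h.two_le_arg,
    fun i => (h.arg_lt i).trans (Nat.lt_succ_self b), fun i => (h.arg_lt i).ne, h.input, h.arg,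
    h.free b le_rfl, fun j hj => h.free j (by omega)⟩
  have ha : ∀ i m, a i ≠ b + m := fun i m => by have := h.arg_lt i; omega
  obtain ⟨t₂, ht₂, he₂⟩ := hP0 w x a (b + 2) (b + 3)
    (Function.update s b (List.replicate (n w x) true)) ⟨by omega, by omega, h.two_le_arg,
    fun i => (h.arg_lt i).trans (by omega), fun i => ha i 2,
    by rw [Function.update_of_ne (by omega), h.input],
    fun i => by rw [Function.update_of_ne (h.arg_lt i).ne, h.arg],
    by rw [Function.update_of_ne (by omega), h.free _ (by omega)],
    fun j hj => by rw [Function.update_of_ne (by omega), h.free j (by omega)]⟩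
  set S : ℕ → Stacks := fun i => Function.update (Function.update (Function.update s b
    (List.replicate (n w x - i) true)) (b + 1) (List.replicate i true)) (b + 2)
    (List.replicate (F w x i) true) with hS
  have hSb : ∀ i, S i b = List.replicate (n w x - i) true := fun i => by
    simp [hS]
  have hS1 : ∀ i, S i (b + 1) = List.replicate i true := fun i => by
    simp [hS]
  have hS2 : ∀ i, S i (b + 2) = List.replicate (F w x i) true := fun i => by
    simp [hS]
  have hSo : ∀ i j, j ≠ b → j ≠ b + 1 → j ≠ b + 2 → S i j = s j := fun i j h0 h1 h2 => by
    simp [hS, Function.update_of_ne h0, Function.update_of_ne h1, Function.update_of_ne h2]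
  obtain ⟨t₃, ht₃, he₃⟩ := exec_loop_unary (c := b) (n := n w x) (τ := τ w x) (Q := skip)
    (P := seq (PG (Fin.cons (b + 1) (Fin.cons (b + 2) a)) (b + 3) (b + 4))
        (seq (clear (b + 2)) (seq (move (b + 3) (b + 2)) (push (b + 1) true)))) S
    (fun i _ => hSb i) (fun i hi => by
      set s₁ := Function.update (S i) b (List.replicate (n w x - (i + 1)) true) with hs₁
      have hs₁o : ∀ j, j ≠ b → s₁ j = S i j := fun j hj => Function.update_of_ne hj _ _
      obtain ⟨t, ht, he⟩ := hPG w (Fin.cons i (Fin.cons (F w x i) x))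
        (Fin.cons (b + 1) (Fin.cons (b + 2) a)) (b + 3) (b + 4) s₁ ⟨by omega, by omega,
        fun i => by
          refine Fin.cases ?_ (fun i => Fin.cases ?_ (fun i => ?_) i) i
          · exact (by omega : 2 ≤ b + 1)
          · exact (by omega : 2 ≤ b + 2)
          · exact h.two_le_arg i,
        fun i => by
          refine Fin.cases ?_ (fun i => Fin.cases ?_ (fun i => ?_) i) i
          · exact (by omega : b + 1 < b + 4)
          · exact (by omega : b + 2 < b + 4)
          · exact (h.arg_lt i).trans (by omega),
        fun i => by
          refine Fin.cases ?_ (fun i => Fin.cases ?_ (fun i => ?_) i) i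
          · exact (by omega : b + 1 ≠ b + 3)
          · exact (by omega : b + 2 ≠ b + 3)
          · exact ha i 3,
        by rw [hs₁o 0 (by omega), hSo i 0 (by omega) (by omega) (by omega), h.input],
        fun j => by
          refine Fin.cases ?_ (fun j => Fin.cases ?_ (fun j => ?_) j) j
          · exact (hs₁o (b + 1) (by omega)).trans (hS1 i)
          · exact (hs₁o (b + 2) (by omega)).trans (hS2 i)
          · exact ((hs₁o _ (ha j 0)).trans (hSo i _ (ha j 0) (ha j 1) (ha j 2))).trans (h.arg j),
        by rw [hs₁o _ (by omega), hSo i _ (by omega) (by omega) (by omega), h.free _ (by omega)],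
        fun j hj => by
          rw [hs₁o _ (by omega), hSo i _ (by omega) (by omega) (by omega), h.free _ (by omega)]⟩
      rw [← hF w x i hi] at he
      have e2 := exec_clear (b + 2) (Function.update s₁ (b + 3)
        (List.replicate (F w x (i + 1)) true))
      have e3 := exec_move_unary (k := b + 3) (d := b + 2) (m := F w x (i + 1)) (n := 0)
        (s := Function.update (Function.update s₁ (b + 3)
        (List.replicate (F w x (i + 1)) true)) (b + 2) []) (by omega) (by simp) (by simp)
      rw [Function.update_of_ne (by omega), hs₁o _ (by omega), hS2, List.length_replicate] at e2
      refine ⟨_, ?_, (Exec.seq he (Exec.seq e2 (Exec.seq e3 (Exec.push _ _ _)))).congr ?_⟩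
      · have h1 := hFB w x i hi.le
        have h2 := hFB w x (i + 1) hi
        have h3 : DiColoring.size w (Fin.cons i (Fin.cons (F w x i) x) : Fin (k + 2) → ℕ) ^ c ≤
            (w.length + (n w x + (B w x + ∑ i, x i)) + 2) ^ c := by
          refine Nat.pow_le_pow_left ?_ c
          unfold DiColoring.size
          rw [Fin.sum_univ_succ, Fin.sum_univ_succ]
          simp only [Fin.cons_zero, Fin.cons_succ]
          omega
        have h4 := hc w (Fin.cons i (Fin.cons (F w x i) x))
        simp only [hτ]
        omega
      · have h3 : s (b + 3) = [] := h.free _ (by omega)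
        funext j
        by_cases hj : j = b
        · subst hj
          simp [hs₁, hS]
        by_cases hj1 : j = b + 1
        · subst hj1
          simp [hs₁, hS, List.replicate_succ]
        by_cases hj2 : j = b + 2
        · subst hj2
          simp [hS]
        by_cases hj3 : j = b + 3
        · subst hj3
          simp [hS, h3]
        · simp [hs₁, hS, hj, hj1, hj2, hj3])
  have e₀ : Function.update (Function.update s b (List.replicate (n w x) true)) (b + 2)
      (List.replicate (F w x 0) true) = S 0 := by
    funext j
    have h3 : s (b + 1) = [] := h.free _ (by omega)
    simp only [Function.update_apply, hS]
    split_ifs <;> simp_all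
  rw [e₀] at he₂
  have e4 := exec_move_unary (k := b + 2) (d := d) (m := F w x (n w x)) (n := 0)
    (s := S (n w x)) (by omega) (hS2 _)
    (by rw [hSo _ _ (by omega) (by omega) (by omega), h.dest]; rfl)
  have e5 := exec_clear (b + 1) (Function.update (Function.update (S (n w x)) (b + 2) []) d
    (List.replicate (F w x (n w x) + 0) true))
  rw [Function.update_of_ne (by omega), Function.update_of_ne (by omega), hS1,
    List.length_replicate] at e5
  refine ⟨_, ?_, (Exec.seq he₁ (Exec.seq he₂ (Exec.seq he₃ (Exec.seq e4 e5)))).congr ?_⟩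
  · have h1 := hFB w x (n w x) le_rfl
    beta_reduce
    omega
  · funext j
    have h3 : s b = [] := h.free _ (by omega)
    have h4 : s (b + 1) = [] := h.free _ (by omega)
    have h5 : s (b + 2) = [] := h.free _ (by omega)
    simp only [Function.update_apply, hS]
    split_ifs <;> first | omega | simp_all

end UnaryPoly
end DiColoring

/-! ### Reading bits of the input and writing an output bit by bit. -/

namespace DiColoring

open StackProg

/-- The bit of a string at a position, as a number; it is `0` beyond the end. -/
def bitAt (w : List Bool) (i : ℕ) : ℕ := if w[i]? = some true then 1 else 0

/-- The input can only be measured by consuming it. One pass counts the bits and keeps them,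
reversed, on `e`, from where they can be moved back. -/
theorem exec_count_move {k d e : ℕ} (hkd : k ≠ d) (hke : k ≠ e) (hde : d ≠ e) (s : Stacks) :
    Exec (loop k (seq (push e true) (push d true)) (seq (push e false) (push d true))) s
      (Function.update (Function.update (Function.update s k []) e ((s k).reverse ++ s e)) d
        (List.replicate (s k).length true ++ s d)) (3 * (s k).length + 1) := by
  generalize hl : s k = l
  induction l generalizing s with
  | nil =>
    refine (Exec.loop_nil hl).congr ?_
    funext j
    simp only [Function.update_apply]
    split_ifs <;> simp_all
  | cons b l ih =>
    have h := ih (Function.update (Function.update (Function.update s k l) e (b :: s e)) d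
      (true :: s d)) (by simp [hkd, hke])
    have ht : 3 * (b :: l).length + 1 = 1 + (1 + 1) + (3 * l.length + 1) := by
      rw [List.length_cons]; omega
    rw [ht]
    have hstep : ∀ b, Exec (seq (push e b) (push d true)) (Function.update s k l)
        (Function.update (Function.update (Function.update s k l) e (b :: s e)) d (true :: s d))
        (1 + 1) := by
      intro b
      refine (Exec.seq (Exec.push _ _ _) (Exec.push _ _ _)).congr ?_
      simp [Function.update_of_ne hke.symm, Function.update_of_ne hkd.symm,
        Function.update_of_ne hde]
    have hr : List.replicate l.length true ++ true :: s d =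
        List.replicate (l.length + 1) true ++ s d := by
      rw [List.replicate_succ', List.append_assoc]
      rfl
    cases b
    · refine (Exec.loop_false hl (hstep _) h).congr ?_
      funext j
      simp only [Function.update_apply]
      split_ifs <;> simp_all
    · refine (Exec.loop_true hl (hstep _) h).congr ?_
      funext j
      simp only [Function.update_apply]
      split_ifs <;> simp_all

namespace UnaryPoly

variable {k : ℕ}

theorem length : UnaryPoly (fun w (_ : Fin k → ℕ) => w.length) := by
  refine ⟨PolyBdd.length, fun _ d b => seq (loop 0 (seq (push b true) (push d true))
    (seq (push b false) (push d true))) (move b 0),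
    fun w _ => (3 * w.length + 1) + (2 * w.length + 1),
    (((PolyBdd.const 3).mul PolyBdd.length).add (PolyBdd.const 1)).add
      (((PolyBdd.const 2).mul PolyBdd.length).add (PolyBdd.const 1)), ?_⟩
  intro w x a d b s h
  have hlt := h.lt
  have h2 := h.two_le
  have hb := h.free b le_rfl
  have hd := h.dest
  have h0 := h.input
  have e1 := exec_count_move (k := 0) (d := d) (e := b) (by omega) (by omega) (by omega) s
  rw [hb, hd, h0, List.append_nil, List.append_nil] at e1
  have e2 := exec_move (k := b) (d := 0) (by omega) (Function.update (Function.update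
    (Function.update s 0 []) b w.reverse) d (List.replicate w.length true))
  rw [Function.update_of_ne (by omega), Function.update_self, List.length_reverse,
    List.reverse_reverse, Function.update_of_ne (by omega), Function.update_of_ne (by omega),
    Function.update_self, List.append_nil] at e2
  refine ⟨_, le_rfl, (Exec.seq e1 e2).congr ?_⟩
  funext j
  simp only [Function.update_apply]
  split_ifs <;> first | omega | simp_all

theorem bitAt : UnaryPoly (fun w (x : Fin 1 → ℕ) => bitAt w (x 0)) := by
  refine ⟨(PolyBdd.const 1).mono fun w x => by unfold DiColoring.bitAt; split_ifs <;> omega,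
    -- The first `x 0` bits are moved to stack `b + 1`. The next bit is popped, recorded in `d` and
    -- pushed back, and then the moved bits are restored.
    fun a d b => seq (copy (a 0) b (b + 1)) (seq
      (loop b (case 0 (push (b + 1) true) (push (b + 1) false) skip) skip) (seq
      (case 0 (seq (push 0 true) (push d true)) (push 0 false) skip) (move (b + 1) 0))),
    fun w x => (5 * x 0 + 2) + ((x 0 * (2 + 1) + 1) + (3 + (2 * w.length + 1))),
    (((PolyBdd.const 5).mul (PolyBdd.arg 0)).add (PolyBdd.const 2)).add
    ((((PolyBdd.arg 0).mul (PolyBdd.const 3)).add (PolyBdd.const 1)).add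
      ((PolyBdd.const 3).add
        (((PolyBdd.const 2).mul PolyBdd.length).add (PolyBdd.const 1)))), ?_⟩
  intro w x a d b s h
  have hlt := h.lt
  have h2 := h.two_le
  have hb := h.free b le_rfl
  have hb1 := h.free (b + 1) (by omega)
  have hd := h.dest
  have h0 := h.input
  obtain ⟨t₁, ht₁, e₁⟩ := exec_copy (d := b) (e := b + 1) (h.arg_lt 0).ne
    (by have := h.arg_lt 0; omega) (by omega) (h.arg 0) hb hb1
  obtain ⟨t₂, ht₂, e₂⟩ := exec_loop_unary (c := b) (n := x 0) (τ := 2) (Q := skip)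
    (P := case 0 (push (b + 1) true) (push (b + 1) false) skip)
    (fun i => Function.update (Function.update (Function.update s b
      (List.replicate (x 0 - i) true)) (b + 1) (w.take i).reverse) 0 (w.drop i))
    (fun i _ => by simp [show b ≠ 0 by omega]) (fun i hi => by
      rcases hw : w.drop i with _ | ⟨c, l⟩
      -- Past the end of the input a round does nothing, and `take` and `drop` no longer change.
      · refine ⟨1 + 1, le_rfl, (Exec.case_nil ?_ (Exec.skip _)).congr ?_⟩
        · simp [show 0 ≠ b by omega]
        · have h1 : w.length ≤ i := List.drop_eq_nil_iff.mp hw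
          have h3 : w.drop (i + 1) = [] := List.drop_eq_nil_iff.mpr (by omega)
          rw [h3, List.take_of_length_le h1, List.take_of_length_le (by omega)]
          funext j
          simp only [Function.update_apply]
          split_ifs <;> first | omega | simp_all
      · have hg : w[i]? = some c := by
          rw [← List.head?_drop, hw]; rfl
        have h3 : w.drop (i + 1) = l := by
          rw [← List.tail_drop, hw]; rfl
        have h4 : (w.take (i + 1)).reverse = c :: (w.take i).reverse := by
          rw [List.take_add_one, hg]; simp
        rw [h3, h4]
        refine ⟨1 + 1, le_rfl, ?_⟩
        cases c
        · refine (Exec.case_false (l := l) ?_ (Exec.push _ _ _)).congr ?_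
          · simp [show 0 ≠ b by omega]
          · funext j
            simp only [Function.update_apply]
            split_ifs <;> first | omega | simp_all
        · refine (Exec.case_true (l := l) ?_ (Exec.push _ _ _)).congr ?_
          · simp [show 0 ≠ b by omega]
          · funext j
            simp only [Function.update_apply]
            split_ifs <;> first | omega | simp_all)
  have hs₁ : Function.update s b (List.replicate (x 0) true) = Function.update (Function.update
      (Function.update s b (List.replicate (x 0 - 0) true)) (b + 1) (w.take 0).reverse) 0
      (w.drop 0) := by
    funext j
    simp only [Function.update_apply]
    split_ifs <;> first | omega | simp_all
  rw [hs₁] at e₁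
  set s₂ := Function.update (Function.update (Function.update s b
      (List.replicate (x 0 - x 0) true)) (b + 1) (w.take (x 0)).reverse) 0 (w.drop (x 0)) with hs₂
  have h20 : s₂ 0 = w.drop (x 0) := Function.update_self _ _ _
  have h2d : s₂ d = [] := by
    rw [hs₂, Function.update_of_ne (by omega), Function.update_of_ne (by omega),
      Function.update_of_ne (by omega), hd]
  have e₃ : ∃ t ≤ 3, Exec (case 0 (seq (push 0 true) (push d true)) (push 0 false) skip) s₂
      (Function.update s₂ d (List.replicate (DiColoring.bitAt w (x 0)) true)) t := by
    rcases hw : w.drop (x 0) with _ | ⟨c, l⟩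
    · have hg : w[x 0]? = none := by
        rw [← List.head?_drop, hw]; rfl
      refine ⟨1 + 1, by omega, (Exec.case_nil (h20.trans hw) (Exec.skip _)).congr ?_⟩
      rw [DiColoring.bitAt, hg, if_neg (by simp), List.replicate_zero, ← h2d,
        Function.update_eq_self]
    · have hg : w[x 0]? = some c := by
        rw [← List.head?_drop, hw]; rfl
      have h3 : Function.update s₂ 0 (c :: l) = s₂ := by
        rw [← hw, ← h20, Function.update_eq_self]
      cases c
      · refine ⟨1 + 1, by omega, (Exec.case_false (h20.trans hw) (Exec.push _ _ _)).congr ?_⟩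
        rw [DiColoring.bitAt, hg, if_neg (by simp), List.replicate_zero, Function.update_self,
          Function.update_idem, h3, ← h2d, Function.update_eq_self]
      · refine ⟨1 + (1 + 1), by omega, (Exec.case_true (h20.trans hw)
          (Exec.seq (Exec.push _ _ _) (Exec.push _ _ _))).congr ?_⟩
        rw [DiColoring.bitAt, hg, if_pos rfl, Function.update_self, Function.update_idem, h3, h2d]
        rfl
  obtain ⟨t₃, ht₃, e₃⟩ := e₃
  have e₄ := exec_move (k := b + 1) (d := 0) (by omega) (Function.update s₂ d
    (List.replicate (DiColoring.bitAt w (x 0)) true))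
  have h21 : s₂ (b + 1) = (w.take (x 0)).reverse := by
    rw [hs₂, Function.update_of_ne (by omega), Function.update_self]
  rw [Function.update_of_ne (by omega), Function.update_of_ne (by omega), h20, h21,
    List.reverse_reverse, List.take_append_drop, List.length_reverse] at e₄
  refine ⟨_, ?_, (Exec.seq e₁ (Exec.seq e₂ (Exec.seq e₃ e₄))).congr ?_⟩
  · have : (w.take (x 0)).length ≤ w.length := List.length_take_le' _ _
    beta_reduce
    omega
  · funext j
    by_cases hj0 : j = 0
    · subst hj0
      simp [h0, show 0 ≠ d by omega]
    by_cases hjb : j = b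
    · subst hjb
      simp [hs₂, hj0, hlt.ne', hb]
    by_cases hjb1 : j = b + 1
    · subst hjb1
      simp [hb1, show b + 1 ≠ d by omega]
    · by_cases hjd : j = d
      · subst hjd
        simp [hj0, hjb1]
      · simp [hs₂, hj0, hjb, hjb1, hjd]

end UnaryPoly

/-- A program that outputs a string, given by its length and its bits. -/
theorem exists_exec_of_unaryPoly {ℓ : List Bool → ℕ} {f : List Bool → ℕ → ℕ}
    (hℓ : UnaryPoly (fun w (_ : Fin 0 → ℕ) => ℓ w))
    (hf : UnaryPoly (fun w (x : Fin 1 → ℕ) => f w (x 0))) (hf1 : ∀ w i, f w i ≤ 1) :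
    ∃ P c, ∀ w : List Bool, ∃ t ≤ (w.length + 2) ^ c, Exec P (single 0 w)
      (single 1 ((List.range (ℓ w)).map fun i => f w i == 1).reverse) t := by
  obtain ⟨hℓb, Pℓ, Tℓ, hTℓ, hPℓ⟩ := hℓ
  obtain ⟨-, Pf, Tf, hTf, hPf⟩ := hf
  obtain ⟨c, hc⟩ := hTf
  have hb : PolyBdd (fun w (x : Fin 0 → ℕ) => Tℓ w x + (((ℓ w * ((w.length + ℓ w + 2) ^ c + 3 + 1)
      + 1) + ((2 * ℓ w + 1) + (2 * w.length + 1))))) :=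
    hTℓ.add (((hℓb.mul ((((PolyBdd.length.add hℓb).add (PolyBdd.const 2)).pow c).add
      (PolyBdd.const 3) |>.add (PolyBdd.const 1))).add (PolyBdd.const 1)).add
      ((((PolyBdd.const 2).mul hℓb).add (PolyBdd.const 1)).add
      (((PolyBdd.const 2).mul PolyBdd.length).add (PolyBdd.const 1))))
  obtain ⟨C, hC⟩ := hb
  -- Register `2` counts down the remaining bits, `3` holds the index and `4` the computed value. As
  -- this value is `0` or `1`, the single pop by `case` also empties register `4` for the next
  -- round.
  refine ⟨seq (Pℓ ![] 2 3) (seq (loop 2 (seq (Pf ![3] 4 5)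
    (seq (case 4 (push 1 true) skip (push 1 false)) (push 3 true))) skip)
    (seq (clear 3) (clear 0))), C, fun w => ?_⟩
  have hs0 : ∀ j, j ≠ 0 → single 0 w j = [] := fun j hj => Function.update_of_ne hj _ _
  obtain ⟨t₁, ht₁, e₁⟩ := hPℓ w ![] ![] 2 3 (single 0 w) ⟨le_rfl, by omega, fun i => i.elim0,
    fun i => i.elim0, fun i => i.elim0, by simp [single], fun i => i.elim0, hs0 _ (by omega),
    fun j hj => hs0 j (by omega)⟩
  set S : ℕ → Stacks := fun i => Function.update (Function.update (Function.update (single 0 w) 1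
    ((List.range i).map fun i => f w i == 1).reverse) 2 (List.replicate (ℓ w - i) true)) 3
    (List.replicate i true) with hS
  have hSo : ∀ i j, 4 ≤ j → S i j = [] := by
    intro i j hj
    simp only [hS]
    rw [Function.update_of_ne (by omega), Function.update_of_ne (by omega),
      Function.update_of_ne (by omega), hs0 j (by omega)]
  obtain ⟨t₂, ht₂, e₂⟩ := exec_loop_unary (c := 2) (n := ℓ w) (τ := (w.length + ℓ w + 2) ^ c + 3)
    (Q := skip) (P := seq (Pf ![3] 4 5)
    (seq (case 4 (push 1 true) skip (push 1 false)) (push 3 true))) S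
    (fun i _ => by simp [hS]) (fun i hi => by
      set s₁ := Function.update (S i) 2 (List.replicate (ℓ w - (i + 1)) true) with hs₁
      have h1o : ∀ j, 4 ≤ j → s₁ j = [] := fun j hj => by
        rw [hs₁, Function.update_of_ne (by omega), hSo i j hj]
      obtain ⟨t, ht, e⟩ := hPf w ![i] ![3] 4 5 s₁ ⟨by omega, by omega,
        fun i => by fin_cases i; simp, fun i => by fin_cases i; simp,
        fun i => by fin_cases i; simp, by simp [hs₁, hS, single],
        fun j => by fin_cases j; simp [hs₁, hS],
        h1o 4 le_rfl, fun j hj => h1o j (by omega)⟩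
      have htb : t ≤ (w.length + ℓ w + 2) ^ c := by
        refine ht.trans ((hc _ _).trans (Nat.pow_le_pow_left ?_ c))
        simp only [size, Finset.univ_unique, Finset.sum_singleton, Matrix.cons_val_fin_one]
        omega
      refine ⟨t + (1 + 1 + 1), by omega, ?_⟩
      simp only [Matrix.cons_val_fin_one] at e
      have h14 := h1o 4 le_rfl
      have hr : List.range (i + 1) = List.range i ++ [i] := List.range_succ
      rcases Nat.le_one_iff_eq_zero_or_eq_one.mp (hf1 w i) with h0 | h1
      · rw [h0] at e
        refine (Exec.seq e (Exec.seq (Exec.case_nil (by simp) (Exec.push _ _ _))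
          (Exec.push _ _ _))).congr ?_
        funext j
        simp only [Function.update_apply, hs₁, hS]
        by_cases hj1 : j = 1
        · simp [hj1, hr, h0]
        by_cases hj3 : j = 3
        · simp [hj3, List.replicate_succ]
        by_cases hj4 : j = 4
        · simp [hj4, hs0]
        · simp only [hj1, hj3, hj4, if_false]
          split_ifs <;> rfl
      · rw [h1] at e
        refine (Exec.seq e (Exec.seq (Exec.case_true (l := []) (by simp) (Exec.push _ _ _))
          (Exec.push _ _ _))).congr ?_
        funext j
        simp only [Function.update_apply, hs₁, hS]
        by_cases hj1 : j = 1
        · simp [hj1, hr, h1]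
        by_cases hj3 : j = 3
        · simp [hj3, List.replicate_succ]
        by_cases hj4 : j = 4
        · simp [hj4, hs0]
        · simp only [hj1, hj3, hj4, if_false]
          split_ifs <;> rfl)
  have h0 : Function.update (single 0 w) 2 (List.replicate (ℓ w) true) = S 0 := by
    funext j
    have := hs0 1
    have := hs0 3
    simp only [Function.update_apply, hS]
    split_ifs <;> first | omega | simp_all
  rw [h0] at e₁
  have e₃ := exec_clear 3 (S (ℓ w))
  have e₄ := exec_clear 0 (Function.update (S (ℓ w)) 3 [])
  have h3 : S (ℓ w) 3 = List.replicate (ℓ w) true := by simp [hS]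
  have h00 : S (ℓ w) 0 = w := by simp [hS, single]
  rw [h3, List.length_replicate] at e₃
  rw [Function.update_of_ne (by omega), h00] at e₄
  refine ⟨_, ?_, (Exec.seq e₁ (Exec.seq e₂ (Exec.seq e₃ e₄))).congr ?_⟩
  · have h1 := hC w ![]
    have h2 : size w (![] : Fin 0 → ℕ) = w.length + 2 := by simp [size]
    beta_reduce at h1
    rw [h2] at h1
    omega
  · funext j
    simp only [Function.update_apply, hS, single]
    split_ifs <;> first | omega | simp_all

end DiColoring

/-! ### Arithmetic, predicates and bounded search on unary registers. -/

namespace DiColoring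

open Classical in
/-- A predicate that can be decided in polynomial time on unary registers. -/
def UnaryPolyPred {k : ℕ} (p : List Bool → (Fin k → ℕ) → Prop) : Prop :=
  UnaryPoly (fun w x => if p w x then 1 else 0)

namespace UnaryPoly

variable {k : ℕ} {f g h : List Bool → (Fin k → ℕ) → ℕ}

theorem polyBdd (hf : UnaryPoly f) : PolyBdd f := hf.1

theorem shift₂ (hf : UnaryPoly f) :
    UnaryPoly (fun w (y : Fin (k + 2) → ℕ) => f w (fun i => y i.succ.succ)) :=
  hf.rename _

theorem add (hf : UnaryPoly f) (hg : UnaryPoly g) : UnaryPoly (fun w x => f w x + g w x) :=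
  recur (F := fun w x i => f w x + i) (G := fun w y => y 1 + 1) hg hf (arg 1).succ
    (fun _ _ _ _ => rfl) (hf.polyBdd.add hg.polyBdd) (fun _ _ _ hi => by omega)

/-- The recursion forgets the previous value and returns the index, which is the predecessor of the
next one. -/
theorem pred (hf : UnaryPoly f) : UnaryPoly (fun w x => f w x - 1) :=
  recur (F := fun w x i => i - 1) (G := fun w y => y 0) hf (const 0) (arg 0)
    (fun _ _ _ _ => rfl) hf.polyBdd (fun _ _ _ hi => by omega)

theorem sub (hf : UnaryPoly f) (hg : UnaryPoly g) : UnaryPoly (fun w x => f w x - g w x) :=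
  recur (F := fun w x i => f w x - i) (G := fun w y => y 1 - 1) hg hf (arg 1).pred
    (fun _ _ _ _ => rfl) hf.polyBdd (fun _ _ _ hi => by omega)

theorem mul (hf : UnaryPoly f) (hg : UnaryPoly g) : UnaryPoly (fun w x => f w x * g w x) :=
  recur (F := fun w x i => f w x * i) (G := fun w y => y 1 + f w (fun i => y i.succ.succ)) hg
    (const 0) ((arg 1).add hf.shift₂)
    (fun _ _ _ _ => rfl) (hf.polyBdd.mul hg.polyBdd) (fun _ _ _ hi => Nat.mul_le_mul_left _ hi)

/-- A branch is a recursion of length `f` in which every round returns `h`: the initial value `g`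
survives only if there is no round. -/
theorem ite_zero (hf : UnaryPoly f) (hg : UnaryPoly g) (hh : UnaryPoly h) :
    UnaryPoly (fun w x => if f w x = 0 then g w x else h w x) :=
  recur (F := fun w x i => if i = 0 then g w x else h w x)
    (G := fun w y => h w (fun i => y i.succ.succ)) hf hg hh.shift₂
    (fun _ _ _ _ => rfl) (hg.polyBdd.add hh.polyBdd)
    (fun _ _ _ hi => by split_ifs <;> omega)

end UnaryPoly

namespace UnaryPolyPred

open UnaryPoly

variable {k : ℕ} {f g : List Bool → (Fin k → ℕ) → ℕ} {p q : List Bool → (Fin k → ℕ) → Prop}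

theorem congr (hp : UnaryPolyPred p) (h : ∀ w x, p w x ↔ q w x) : UnaryPolyPred q := by
  have : p = q := funext fun w => funext fun x => propext (h w x)
  rwa [← this]

theorem ite [∀ w x, Decidable (p w x)] (hp : UnaryPolyPred p) (hf : UnaryPoly f)
    (hg : UnaryPoly g) : UnaryPoly (fun w x => if p w x then f w x else g w x) :=
  (ite_zero hp hg hf).congr fun w x => by by_cases h : p w x <;> simp [h]

theorem eq_zero (hf : UnaryPoly f) : UnaryPolyPred (fun w x => f w x = 0) :=
  (ite_zero hf (const 1) (const 0)).congr fun w x => by by_cases h : f w x = 0 <;> simp [h]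

theorem le (hf : UnaryPoly f) (hg : UnaryPoly g) : UnaryPolyPred (fun w x => f w x ≤ g w x) :=
  (eq_zero (hf.sub hg)).congr fun _ _ => Nat.sub_eq_zero_iff_le

theorem lt (hf : UnaryPoly f) (hg : UnaryPoly g) : UnaryPolyPred (fun w x => f w x < g w x) :=
  le hf.succ hg

theorem not (hp : UnaryPolyPred p) : UnaryPolyPred (fun w x => ¬ p w x) :=
  (eq_zero hp).congr fun w x => by by_cases h : p w x <;> simp [h]

theorem and (hp : UnaryPolyPred p) (hq : UnaryPolyPred q) :
    UnaryPolyPred (fun w x => p w x ∧ q w x) :=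
  (UnaryPoly.mul hp hq).congr fun w x => by
    by_cases h : p w x <;> by_cases h' : q w x <;> simp [h, h']

theorem or (hp : UnaryPolyPred p) (hq : UnaryPolyPred q) :
    UnaryPolyPred (fun w x => p w x ∨ q w x) :=
  (hp.not.and hq.not).not.congr fun w x => by tauto

theorem eq (hf : UnaryPoly f) (hg : UnaryPoly g) : UnaryPolyPred (fun w x => f w x = g w x) :=
  ((le hf hg).and (le hg hf)).congr fun _ _ => le_antisymm_iff.symm

theorem ne (hf : UnaryPoly f) (hg : UnaryPoly g) : UnaryPolyPred (fun w x => f w x ≠ g w x) :=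
  (eq hf hg).not

/-- Bounded existential quantification. -/
theorem exists_lt {r : List Bool → (Fin (k + 1) → ℕ) → Prop} (hf : UnaryPoly f)
    (hr : UnaryPolyPred r) : UnaryPolyPred (fun w x => ∃ i < f w x, r w (Fin.cons i x)) := by
  classical
  -- A round receives the index, the previous truth value and the arguments; the renaming leaves out
  -- the previous truth value.
  have hr' : UnaryPolyPred (fun w (y : Fin (k + 2) → ℕ) =>
      r w (fun i => y ((Fin.cons 0 fun j => j.succ.succ : Fin (k + 1) → Fin (k + 2)) i))) :=
    UnaryPoly.rename hr _
  refine (recur (F := fun w x n => if ∃ i < n, r w (Fin.cons i x) then 1 else 0) hf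
    ((const 0).congr fun w x => by simp) ((eq_zero (arg 1)).not.or hr') ?_ (PolyBdd.const 1)
    fun w x i _ => by split_ifs <;> omega).congr fun w x => ?_
  · intro w x n _
    have hc : (fun i => (Fin.cons n (Fin.cons (if ∃ i < n, r w (Fin.cons i x) then 1 else 0) x) :
        Fin (k + 2) → ℕ) ((Fin.cons 0 fun j => j.succ.succ : Fin (k + 1) → Fin (k + 2)) i)) =
        Fin.cons n x := by
      funext i
      cases i using Fin.cases <;> rfl
    beta_reduce
    rw [hc]
    have h1 : (∃ i < n + 1, r w (Fin.cons i x)) ↔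
        (∃ i < n, r w (Fin.cons i x)) ∨ r w (Fin.cons n x) := by
      constructor
      · rintro ⟨i, hi, h⟩
        rcases Nat.lt_succ_iff_lt_or_eq.mp hi with hi | rfl
        · exact Or.inl ⟨i, hi, h⟩
        · exact Or.inr h
      · rintro (⟨i, hi, h⟩ | h)
        · exact ⟨i, by omega, h⟩
        · exact ⟨n, by omega, h⟩
    have h2 : (Fin.cons n (Fin.cons (if ∃ i < n, r w (Fin.cons i x) then 1 else 0) x) :
        Fin (k + 2) → ℕ) 1 = if ∃ i < n, r w (Fin.cons i x) then 1 else 0 := rfl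
    rw [h2]
    by_cases h3 : ∃ i < n, r w (Fin.cons i x)
    · rw [if_pos (h1.mpr (Or.inl h3)), if_pos h3, if_pos (Or.inl (by simp))]
    · rw [if_neg h3]
      by_cases h4 : r w (Fin.cons n x)
      · rw [if_pos (h1.mpr (Or.inr h4)), if_pos (Or.inr h4)]
      · rw [if_neg (fun h => not_or.mpr ⟨h3, h4⟩ (h1.mp h)), if_neg (by simp [h4])]
  · congr

end UnaryPolyPred

namespace UnaryPoly

open UnaryPolyPred

variable {k : ℕ} {f g h : List Bool → (Fin k → ℕ) → ℕ}

theorem min (hf : UnaryPoly f) (hg : UnaryPoly g) : UnaryPoly (fun w x => min (f w x) (g w x)) :=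
  ((UnaryPolyPred.le hf hg).ite hf hg).congr fun _ _ => (min_def _ _).symm

/-- From `i` to `i + 1` the quotient increases exactly when the divisor divides `i + 1`, and then
the new quotient times the divisor is `i + 1`. So one multiplication decides it, also for the
divisor `0`. -/
theorem div (hf : UnaryPoly f) (hg : UnaryPoly g) : UnaryPoly (fun w x => f w x / g w x) := by
  classical
  refine recur (F := fun w x i => i / g w x) (G := fun w y =>
    if (y 1 + 1) * g w (fun i => y i.succ.succ) = y 0 + 1 then y 1 + 1 else y 1) hf
    ((const 0).congr fun _ _ => (Nat.zero_div _).symm)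
    ((UnaryPolyPred.eq ((arg 1).succ.mul hg.shift₂) (arg 0).succ).ite (arg 1).succ (arg 1))
    ?_ hf.polyBdd (fun w x i hi => (Nat.div_le_self _ _).trans hi)
  intro w x i _
  change (i + 1) / g w x = if (i / g w x + 1) * g w x = i + 1 then i / g w x + 1 else i / g w x
  rw [Nat.succ_div]
  by_cases hd : g w x ∣ i + 1
  · rw [if_pos hd, if_pos]
    have h1 := Nat.succ_div_of_dvd hd
    rw [← h1, Nat.div_mul_cancel hd]
  · rw [if_neg hd, if_neg]
    · rfl
    · intro h
      exact hd ⟨_, (h.symm.trans (Nat.mul_comm _ _))⟩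

theorem mod (hf : UnaryPoly f) (hg : UnaryPoly g) : UnaryPoly (fun w x => f w x % g w x) :=
  (hf.sub (hg.mul (hf.div hg))).congr fun w x => by
    have := Nat.div_add_mod (f w x) (g w x)
    omega

/-- Powers of two, truncated. -/
theorem min_two_pow (hf : UnaryPoly f) (hg : UnaryPoly g) :
    UnaryPoly (fun w x => Min.min (2 ^ f w x) (g w x)) := by
  refine recur (F := fun w x i => Min.min (2 ^ i) (g w x)) (G := fun w y =>
    Min.min (y 1 * 2) (g w (fun i => y i.succ.succ))) hf ((const 1).min hg)
    (((arg 1).mul (const 2)).min hg.shift₂) ?_ hg.polyBdd (fun w x i _ => min_le_right _ _)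
  intro w x i _
  -- Truncating in every round gives the same result as truncating at the end, and keeps all values
  -- at most `g`.
  change Min.min (2 ^ (i + 1)) (g w x) = Min.min (Min.min (2 ^ i) (g w x) * 2) (g w x)
  rw [pow_succ]
  omega

theorem two_pow (hf : UnaryPoly f) (hg : UnaryPoly g) (hfg : ∀ w x, 2 ^ f w x ≤ g w x) :
    UnaryPoly (fun w x => 2 ^ f w x) :=
  (hf.min_two_pow hg).congr fun w x => min_eq_left (hfg w x)

/-- The logarithm increases at `i + 1` exactly when `2 ^ (log i + 1) ≤ i + 1`. The power is cut off
at `i + 2`, which does not affect this comparison and keeps the computation polynomial. -/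
theorem log_two (hf : UnaryPoly f) : UnaryPoly (fun w x => Nat.log 2 (f w x)) := by
  classical
  refine recur (F := fun w x i => Nat.log 2 i) (G := fun w y =>
    if Min.min (2 ^ (y 1 + 1)) (y 0 + 2) ≤ y 0 + 1 then y 1 + 1 else y 1) hf (const 0)
    ((UnaryPolyPred.le ((arg 1).succ.min_two_pow (arg 0).succ.succ) (arg 0).succ).ite
      (arg 1).succ (arg 1)) ?_ hf.polyBdd
    (fun w x i hi => (Nat.log_le_self _ _).trans hi)
  intro w x i _
  change Nat.log 2 (i + 1) = if Min.min (2 ^ (Nat.log 2 i + 1)) (i + 2) ≤ i + 1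
    then Nat.log 2 i + 1 else Nat.log 2 i
  have h1 : i < 2 ^ (Nat.log 2 i + 1) := Nat.lt_pow_succ_log_self (by omega) i
  have h2 : Nat.log 2 i ≤ Nat.log 2 (i + 1) := Nat.log_mono_right (by omega)
  split_ifs with hc
  · rw [min_le_iff] at hc
    have hc' : 2 ^ (Nat.log 2 i + 1) = i + 1 := by omega
    rw [← hc', Nat.log_pow (by omega)]
  · rw [min_le_iff, not_or] at hc
    have : Nat.log 2 (i + 1) < Nat.log 2 i + 1 := Nat.log_lt_of_lt_pow (by omega) (by omega)
    omega

/-- Iteration of a function of one argument that grows by a bounded amount. -/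
theorem iterate {u : List Bool → ℕ → ℕ} {D : List Bool → ℕ}
    (hu : UnaryPoly (fun w (x : Fin 1 → ℕ) => u w (x 0)))
    (hD : ∀ {m}, PolyBdd (fun w (_ : Fin m → ℕ) => D w)) (huD : ∀ w p, u w p ≤ p + D w)
    (hf : UnaryPoly f) (hg : UnaryPoly g) : UnaryPoly (fun w x => (u w)^[f w x] (g w x)) := by
  refine recur (F := fun w x i => (u w)^[i] (g w x)) (G := fun w y => u w (y 1)) hf hg
    (hu.comp₁ (arg 1)) ?_ (hg.polyBdd.add (hf.polyBdd.mul hD)) ?_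
  · intro w x i _
    exact Function.iterate_succ_apply' _ _ _
  · intro w x i hi
    have : ∀ i, (u w)^[i] (g w x) ≤ g w x + i * D w := by
      intro i
      induction i with
      | zero => simp
      | succ i ih =>
        rw [Function.iterate_succ_apply']
        have := huD w ((u w)^[i] (g w x))
        rw [Nat.succ_mul]
        omega
    exact (this i).trans (Nat.add_le_add_left (Nat.mul_le_mul_right _ hi) _)

end UnaryPoly
end DiColoring

namespace DiColoring

/-! ### Reading formulas -/

namespace Scan

/-- The first position from `p` on at which the string has no bit `1`. -/
def ones (w : List Bool) (p : ℕ) : ℕ := (fun a => a + bitAt w a)^[w.length] p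

/-- The position after the literal at position `p`. -/
def litEnd (w : List Bool) (p : ℕ) : ℕ := ones w (p + 1) + 1

/-- The position after the clause at position `p`. -/
def clauseEnd (w : List Bool) (p : ℕ) : ℕ := (litEnd w)^[ones w p - p] (ones w p + 1)

/-- The number of variables of the formula. -/
def numVars (w : List Bool) : ℕ := ones w 0

/-- The number of clauses of the formula. -/
def numClauses (w : List Bool) : ℕ := ones w (ones w 0 + 1) - (ones w 0 + 1)

/-- The position of the `j`-th clause. -/
def clausePos (w : List Bool) (j : ℕ) : ℕ := (clauseEnd w)^[j] (ones w (ones w 0 + 1) + 1)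

/-- The length of the `j`-th clause. -/
def clauseLen (w : List Bool) (j : ℕ) : ℕ := ones w (clausePos w j) - clausePos w j

/-- The position of the `t`-th literal of the `j`-th clause. -/
def litPos (w : List Bool) (j t : ℕ) : ℕ := (litEnd w)^[t] (ones w (clausePos w j) + 1)

/-- The variable of the `t`-th literal of the `j`-th clause. -/
def litVar (w : List Bool) (j t : ℕ) : ℕ := ones w (litPos w j t + 1) - (litPos w j t + 1)

/-- The sign of the `t`-th literal of the `j`-th clause. -/
def litSign (w : List Bool) (j t : ℕ) : ℕ := bitAt w (litPos w j t)

theorem bitAt_le (w : List Bool) (p : ℕ) : bitAt w p ≤ 1 := by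
  unfold bitAt; split_ifs <;> omega

theorem le_iterate {u : ℕ → ℕ} {D : ℕ} (h : ∀ p, u p ≤ p + D) (n p : ℕ) :
    u^[n] p ≤ p + n * D := by
  induction n with
  | zero => simp
  | succ n ih =>
    rw [Function.iterate_succ_apply', Nat.succ_mul]
    have := h (u^[n] p)
    omega

/-- The growth bounds for the scanning functions are needed on all strings, not only on codes of
formulas, because `PolyBdd` quantifies over every input. -/
theorem ones_le (w : List Bool) (p : ℕ) : ones w p ≤ p + w.length := by
  have := le_iterate (u := fun a => a + bitAt w a) (D := 1)
    (fun p => Nat.add_le_add_left (bitAt_le w p) p) w.length p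
  rwa [Nat.mul_one] at this

theorem litEnd_le (w : List Bool) (p : ℕ) : litEnd w p ≤ p + (w.length + 2) := by
  have := ones_le w (p + 1)
  unfold litEnd
  omega

theorem clauseEnd_le (w : List Bool) (p : ℕ) :
    clauseEnd w p ≤ p + (w.length * (w.length + 2) + w.length + 1) := by
  have h1 := le_iterate (litEnd_le w) (ones w p - p) (ones w p + 1)
  have h2 := ones_le w p
  have h3 : (ones w p - p) * (w.length + 2) ≤ w.length * (w.length + 2) :=
    Nat.mul_le_mul_right _ (by omega)
  unfold clauseEnd
  omega

/-! ### Polynomial-time computability of the scanning functions. -/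

section Computable

variable {k : ℕ} {f g : List Bool → (Fin k → ℕ) → ℕ}

theorem unaryPoly_bitAt (hf : UnaryPoly f) : UnaryPoly (fun w x => bitAt w (f w x)) :=
  UnaryPoly.bitAt.comp₁ hf

theorem unaryPoly_ones (hf : UnaryPoly f) : UnaryPoly (fun w x => ones w (f w x)) :=
  UnaryPoly.iterate (u := fun w a => a + bitAt w a) (D := fun _ => 1)
    ((UnaryPoly.arg 0).add UnaryPoly.bitAt) (PolyBdd.const 1)
    (fun w p => Nat.add_le_add_left (bitAt_le w p) p) UnaryPoly.length hf

theorem unaryPoly_litEnd_iterate (hf : UnaryPoly f) (hg : UnaryPoly g) :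
    UnaryPoly (fun w x => (litEnd w)^[f w x] (g w x)) :=
  UnaryPoly.iterate (u := litEnd) (unaryPoly_ones (UnaryPoly.arg 0).succ).succ
    (PolyBdd.length.add (PolyBdd.const 2)) litEnd_le hf hg

theorem unaryPoly_numVars : UnaryPoly (fun w (_ : Fin k → ℕ) => numVars w) :=
  unaryPoly_ones (UnaryPoly.const 0)

theorem unaryPoly_numClauses : UnaryPoly (fun w (_ : Fin k → ℕ) => numClauses w) :=
  (unaryPoly_ones unaryPoly_numVars.succ).sub unaryPoly_numVars.succ

theorem unaryPoly_clausePos (hf : UnaryPoly f) : UnaryPoly (fun w x => clausePos w (f w x)) :=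
  UnaryPoly.iterate (u := clauseEnd)
    (unaryPoly_litEnd_iterate ((unaryPoly_ones (UnaryPoly.arg 0)).sub (UnaryPoly.arg 0))
      (unaryPoly_ones (UnaryPoly.arg 0)).succ)
    (((PolyBdd.length.mul (PolyBdd.length.add (PolyBdd.const 2))).add PolyBdd.length).add
      (PolyBdd.const 1)) clauseEnd_le hf (unaryPoly_ones unaryPoly_numVars.succ).succ

theorem unaryPoly_clauseLen (hf : UnaryPoly f) : UnaryPoly (fun w x => clauseLen w (f w x)) :=
  (unaryPoly_ones (unaryPoly_clausePos hf)).sub (unaryPoly_clausePos hf)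

theorem unaryPoly_litPos (hf : UnaryPoly f) (hg : UnaryPoly g) :
    UnaryPoly (fun w x => litPos w (f w x) (g w x)) :=
  unaryPoly_litEnd_iterate hg (unaryPoly_ones (unaryPoly_clausePos hf)).succ

theorem unaryPoly_litVar (hf : UnaryPoly f) (hg : UnaryPoly g) :
    UnaryPoly (fun w x => litVar w (f w x) (g w x)) :=
  (unaryPoly_ones (unaryPoly_litPos hf hg).succ).sub (unaryPoly_litPos hf hg).succ

theorem unaryPoly_litSign (hf : UnaryPoly f) (hg : UnaryPoly g) :
    UnaryPoly (fun w x => litSign w (f w x) (g w x)) :=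
  unaryPoly_bitAt (unaryPoly_litPos hf hg)

end Computable

/-- Each `1` advances the position and the closing `0` is a fixed point, so surplus iterations do no
harm. The length of `w` provides at least the `n` iterations needed. -/
theorem ones_unary {w u v : List Bool} {n : ℕ} (h : w = u ++ (unary n ++ v)) :
    ones w u.length = u.length + n := by
  have hb : ∀ i < n, bitAt w (u.length + i) = 1 := by
    intro i hi
    subst h
    unfold bitAt
    rw [if_pos]
    rw [List.getElem?_append_right (by omega), Nat.add_sub_cancel_left, unary,
      List.getElem?_append_left (by simp; omega), List.getElem?_append_left (by simp; omega)]
    simp [hi]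
  have hn : bitAt w (u.length + n) = 0 := by
    subst h
    unfold bitAt
    rw [if_neg]
    rw [List.getElem?_append_right (by omega), Nat.add_sub_cancel_left, unary,
      List.getElem?_append_left (by simp), List.getElem?_append_right (by simp)]
    simp
  have h1 : ∀ i ≤ n, (fun a => a + bitAt w a)^[i] u.length = u.length + i := by
    intro i
    induction i with
    | zero => intro _; rfl
    | succ i ih =>
      intro hi
      rw [Function.iterate_succ_apply', ih (by omega), hb i (by omega)]
      rfl
  have h2 : ∀ i, (fun a => a + bitAt w a)^[i] (u.length + n) = u.length + n := by
    intro i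
    induction i with
    | zero => rfl
    | succ i ih => rw [Function.iterate_succ_apply', ih, hn]; rfl
  have hl : w.length = (w.length - n) + n := by
    have : w.length = u.length + (n + 1 + v.length) := by simp [h, unary]; omega
    omega
  unfold ones
  rw [hl, Function.iterate_add_apply, h1 n le_rfl, h2]

/-- The code of a literal. -/
def litCode {n : ℕ} (l : Fin n × Bool) : List Bool := l.2 :: unary l.1.val

/-- The code of a clause. -/
def clauseCode {n : ℕ} (c : List (Fin n × Bool)) : List Bool :=
  unary c.length ++ c.flatMap litCode

theorem length_unary (n : ℕ) : (unary n).length = n + 1 := by simp [unary]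

theorem ones_lit {n : ℕ} {w u v : List Bool} {l : Fin n × Bool} (h : w = u ++ (litCode l ++ v)) :
    ones w (u.length + 1) = u.length + 1 + l.1 := by
  have := ones_unary (w := w) (u := u ++ [l.2]) (v := v) (n := l.1) (by simp [h, litCode])
  simpa using this

theorem litEnd_lit {n : ℕ} {w u v : List Bool} {l : Fin n × Bool} (h : w = u ++ (litCode l ++ v)) :
    litEnd w u.length = (u ++ litCode l).length := by
  unfold litEnd
  rw [ones_lit h, List.length_append, litCode, List.length_cons, length_unary]
  omega

theorem litEnd_iterate {n : ℕ} {w : List Bool} (c : List (Fin n × Bool)) :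
    ∀ {u v : List Bool}, w = u ++ (c.flatMap litCode ++ v) →
      (litEnd w)^[c.length] u.length = (u ++ c.flatMap litCode).length := by
  induction c with
  | nil => intro u v _; simp
  | cons l c ih =>
    intro u v h
    rw [List.flatMap_cons, List.append_assoc] at h
    rw [List.length_cons, Function.iterate_succ_apply, litEnd_lit h,
      ih (v := v) (by simp [h])]
    simp

theorem clauseEnd_clause {n : ℕ} {w u v : List Bool} {c : List (Fin n × Bool)}
    (h : w = u ++ (clauseCode c ++ v)) :
    clauseEnd w u.length = (u ++ clauseCode c).length := by
  rw [clauseCode, List.append_assoc] at h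
  have h1 := ones_unary h
  have h2 := litEnd_iterate c (w := w) (u := u ++ unary c.length) (v := v) (by simp [h])
  unfold clauseEnd
  rw [h1, Nat.add_sub_cancel_left]
  rw [List.length_append, length_unary, ← Nat.add_assoc] at h2
  rw [h2, clauseCode, List.append_assoc]

theorem flatMap_eq_of_lt {α : Type} (l : List α) (f : α → List Bool) {j : ℕ} (hj : j < l.length) :
    l.flatMap f = (l.take j).flatMap f ++ (f l[j] ++ (l.drop (j + 1)).flatMap f) := by
  have h := List.take_append_drop j l
  rw [List.drop_eq_getElem_cons hj] at h
  calc l.flatMap f = (l.take j ++ l[j] :: l.drop (j + 1)).flatMap f := by rw [h]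
    _ = _ := by rw [List.flatMap_append, List.flatMap_cons]

/-! ### Correctness of the scanner on codes of formulas. -/

section Formula

variable (φ : ThreeCNF)

theorem encode_eq : φ.encode = unary φ.numVars ++ (unary φ.numClauses ++
    φ.clauses.flatMap clauseCode) := by
  rw [← List.append_assoc]
  rfl

theorem numVars_encode : numVars φ.encode = φ.numVars := by
  have := ones_unary (u := []) (encode_eq φ)
  rwa [List.length_nil, Nat.zero_add] at this

theorem ones_encode :
    ones φ.encode (φ.numVars + 1) = φ.numVars + 1 + φ.numClauses := by
  have := ones_unary (encode_eq φ)
  rwa [length_unary] at this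

theorem numClauses_encode : numClauses φ.encode = φ.numClauses := by
  have h := numVars_encode φ
  unfold numVars at h
  unfold numClauses
  rw [h, ones_encode]
  omega

/-- Positions are expressed as lengths of prefixes of the code, so that passing from one clause to
the next is an instance of `clauseEnd_clause`. -/
theorem clausePos_encode (j : ℕ) (hj : j ≤ φ.numClauses) :
    clausePos φ.encode j = (unary φ.numVars ++ (unary φ.numClauses ++
      (φ.clauses.take j).flatMap clauseCode)).length := by
  have h := numVars_encode φ
  unfold numVars at h
  induction j with
  | zero =>
    unfold clausePos
    rw [h, ones_encode]
    simp only [Function.iterate_zero, id, List.take_zero, List.flatMap_nil, List.append_nil,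
      List.length_append, length_unary]
    omega
  | succ j ih =>
    have hj' : j < φ.clauses.length := hj
    have ih := ih (by omega)
    unfold clausePos at ih ⊢
    rw [Function.iterate_succ_apply', ih]
    rw [clauseEnd_clause (c := φ.clauses[j]) (v := (φ.clauses.drop (j + 1)).flatMap clauseCode),
      List.take_succ_eq_append_getElem hj', List.flatMap_append, List.flatMap_singleton]
    · simp only [List.append_assoc]
    · rw [encode_eq, flatMap_eq_of_lt _ _ hj']
      simp only [List.append_assoc]

variable {φ} {j : ℕ}

theorem exists_encode_eq (hj : j < φ.clauses.length) : ∃ u v, u.length = clausePos φ.encode j ∧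
    φ.encode = u ++ (clauseCode φ.clauses[j] ++ v) := by
  refine ⟨_, (φ.clauses.drop (j + 1)).flatMap clauseCode, (clausePos_encode φ j hj.le).symm, ?_⟩
  rw [encode_eq, flatMap_eq_of_lt _ _ hj]
  simp only [List.append_assoc]

theorem clauseLen_encode (hj : j < φ.clauses.length) : clauseLen φ.encode j = φ.clauses[j].length := by
  obtain ⟨u, v, hu, h⟩ := exists_encode_eq hj
  rw [clauseCode, List.append_assoc] at h
  unfold clauseLen
  rw [← hu, ones_unary h]
  omega

theorem exists_encode_eq_lit (hj : j < φ.clauses.length) {t : ℕ} (ht : t < φ.clauses[j].length) :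
    ∃ u v, u.length = litPos φ.encode j t ∧
      φ.encode = u ++ (litCode (φ.clauses[j][t]) ++ v) := by
  obtain ⟨u, v, hu, h⟩ := exists_encode_eq hj
  rw [clauseCode, List.append_assoc] at h
  have h3 : φ.encode = (u ++ unary φ.clauses[j].length) ++
      ((φ.clauses[j].take t).flatMap litCode ++ (litCode (φ.clauses[j][t]) ++
        ((φ.clauses[j].drop (t + 1)).flatMap litCode ++ v))) := by
    rw [h, flatMap_eq_of_lt _ _ ht]
    simp only [List.append_assoc]
  refine ⟨_, _, ?_, h3.trans (List.append_assoc _ _ _).symm⟩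
  have h4 := litEnd_iterate _ h3
  rw [List.length_take, Nat.min_eq_left ht.le] at h4
  rw [← h4, litPos, ← hu, ones_unary h]
  simp [length_unary, Nat.add_assoc]

theorem litVar_encode (hj : j < φ.clauses.length) {t : ℕ} (ht : t < φ.clauses[j].length) :
    litVar φ.encode j t = (φ.clauses[j][t]).1 := by
  obtain ⟨u, v, hu, h⟩ := exists_encode_eq_lit hj ht
  rw [litVar, ← hu, ones_lit h]
  omega

theorem litSign_encode (hj : j < φ.clauses.length) {t : ℕ} (ht : t < φ.clauses[j].length) :
    litSign φ.encode j t = if (φ.clauses[j][t]).2 then 1 else 0 := by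
  obtain ⟨u, v, hu, h⟩ := exists_encode_eq_lit hj ht
  rw [litSign, ← hu, bitAt]
  congr 1
  rw [h, List.getElem?_append_right le_rfl, Nat.sub_self]
  simp [litCode]

end Formula

end Scan
end DiColoring

namespace DiColoring

/-! ### Acyclicity and treedepth -/

theorem isAcyclic_of_rank {V : Type*} {D : Digraph V} (ρ : V → ℕ)
    (h : ∀ u v, D.Adj u v → ρ u < ρ v) : IsAcyclic D := by
  have h' : ∀ u v, Relation.TransGen D.Adj u v → ρ u < ρ v := by
    intro u v huv
    induction huv with
    | single h1 => exact h _ _ h1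
    | tail _ h1 ih => exact ih.trans (h _ _ h1)
  exact fun v hv => lt_irrefl _ (h' v v hv)

/-- The vertices of `F` are put back one at a time, each at the price of one `delete` step. -/
theorem HasTreedepthLE.union {V : Type*} [DecidableEq V] {G : SimpleGraph V} {T : Set V} {k : ℕ}
    (hT : HasTreedepthLE G T k) (F : Finset V) (hF : ∀ v ∈ F, v ∉ T) :
    HasTreedepthLE G (T ∪ F) (k + F.card) := by
  induction F using Finset.induction_on with
  | empty => simpa using hT
  | insert a F ha ih =>
    have h1 := ih fun v hv => hF v (Finset.mem_insert_of_mem hv)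
    rw [Finset.card_insert_of_notMem ha, ← Nat.add_assoc]
    refine HasTreedepthLE.delete _ _ a (by simp) ?_
    have h2 : (T ∪ ((insert a F : Finset V) : Set V)) \ {a} = T ∪ F := by
      have h3 := hF a (Finset.mem_insert_self _ _)
      ext v
      by_cases hv : v = a
      · subst hv
        simp [h3, ha]
      · simp [hv]
    rwa [h2]

/-- A set on which adjacent vertices lie in the same block, where blocks have at most `k` vertices,
has treedepth at most `k`. -/
theorem hasTreedepthLE_of_blocks {V : Type*} {G : SimpleGraph V} {T : Set V} {k : ℕ} (β : V → ℕ)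
    (hβ : ∀ u ∈ T, ∀ v ∈ T, G.Adj u v → β u = β v)
    (hk : ∀ i, {v ∈ T | β v = i}.encard ≤ k) : HasTreedepthLE G T k := by
  -- A walk inside `T` stays in its block, so every component lies in one block and is covered by
  -- the `small` case.
  have hreach : ∀ u v : T, (G.induce T).Reachable u v → β u = β v := by
    rintro u v ⟨p⟩
    induction p with
    | nil => rfl
    | cons h _ ih => exact (hβ _ (Subtype.coe_prop _) _ (Subtype.coe_prop _) h).trans ih
  have hsmall : ∀ X : Set V, X ⊆ T → (∀ u ∈ X, ∀ v ∈ X, β u = β v) → X.encard ≤ k := by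
    intro X hX h
    rcases X.eq_empty_or_nonempty with rfl | ⟨u, hu⟩
    · simp
    · have hXu : X ⊆ {v ∈ T | β v = β u} := fun v hv => ⟨hX hv, h v hv u hu⟩
      exact (Set.encard_le_encard hXu).trans (hk (β u))
  by_cases hc : (G.induce T).Preconnected
  · exact HasTreedepthLE.small _ _ (hsmall T subset_rfl fun u hu v hv =>
      hreach ⟨u, hu⟩ ⟨v, hv⟩ (hc _ _))
  · refine HasTreedepthLE.components _ _ hc fun C => HasTreedepthLE.small _ _ (hsmall _ ?_ ?_)
    · rintro _ ⟨v, _, rfl⟩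
      exact v.2
    · rintro _ ⟨u, hu, rfl⟩ _ ⟨v, hv, rfl⟩
      refine hreach u v (SimpleGraph.ConnectedComponent.exact ?_)
      exact ((SimpleGraph.ConnectedComponent.mem_supp_iff _ _).mp hu).trans
        ((SimpleGraph.ConnectedComponent.mem_supp_iff _ _).mp hv).symm

/-! ### The digraph of a formula -/

/-- The data of a formula from which its digraph is built: `m` clauses of exactly three literals,
the variables divided into `G` groups of `q`, values of groups below `L`, and whether there is an
empty clause. -/
structure Frame where
  m : ℕ
  q : ℕ
  L : ℕ
  G : ℕ
  broken : Prop
  var : ℕ → ℕ → ℕ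
  sgn : ℕ → ℕ → ℕ

namespace Frame

/-- Satisfiability of the formula. -/
def Sat (F : Frame) : Prop :=
  ¬ F.broken ∧ ∃ b : ℕ → ℕ, (∀ x, b x < 2) ∧ ∀ j < F.m, ∃ t < 3, b (F.var j t) = F.sgn j t

/-- The hub `0`, the markers `1, …, L + 1` and the `G` group vertices are the vertices below `S`. -/
def S (F : Frame) : ℕ := F.L + 2 + F.G

/-- The number of gadgets, one for each clause and values of the groups of its variables. -/
def gadgets (F : Frame) : ℕ := F.m * (F.L * F.L * F.L)

/-- The number of vertices. -/
def card (F : Frame) : ℕ := F.S + 6 * F.gadgets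

/-- The gadget of a vertex. -/
def gad (F : Frame) (u : ℕ) : ℕ := (u - F.S) / 6

/-- The position of a vertex in its gadget. -/
def pos (F : Frame) (u : ℕ) : ℕ := (u - F.S) % 6

/-- The clause of a gadget. -/
def cl (F : Frame) (c : ℕ) : ℕ := c / (F.L * F.L * F.L)

/-- The value that a gadget supposes for the group of the `t`-th variable. -/
def val (F : Frame) (c t : ℕ) : ℕ :=
  if t = 0 then c % F.L else if t = 1 then c / F.L % F.L else c / (F.L * F.L) % F.L

/-- The `e`-th binary digit. -/
def bit (a e : ℕ) : ℕ := a / 2 ^ e % 2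

/-- The values that the gadget supposes make all literals of the clause false. -/
def Active (F : Frame) (c : ℕ) : Prop :=
  ∀ t < 3, bit (F.val c t) (F.var (F.cl c) t % F.q) ≠ F.sgn (F.cl c) t

/-- The group vertex of a gadget vertex. -/
def grp (F : Frame) (u : ℕ) : ℕ :=
  F.L + 2 + F.var (F.cl (F.gad u)) (F.pos u / 2) / F.q

/-- The marker of a gadget vertex. -/
def mrk (F : Frame) (u : ℕ) : ℕ :=
  1 + F.val (F.gad u) (F.pos u / 2) + F.pos u % 2

/-- The arcs. -/
def Arc (F : Frame) (u v : ℕ) : Prop :=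
  (u = 0 ∧ 1 ≤ v ∧ v < F.S) ∨ (v = 0 ∧ 1 ≤ u ∧ u < F.S) ∨
  (u = 1 ∧ F.L + 2 ≤ v ∧ v < F.S) ∨ (v = F.L + 1 ∧ F.L + 2 ≤ u ∧ u < F.S) ∨
  (F.broken ∧ (u = 1 ∧ v = 2 ∨ u = 2 ∧ v = 1)) ∨
  (F.S ≤ v ∧ (F.pos v % 2 = 0 ∧ u = F.grp v ∨ F.pos v % 2 = 1 ∧ u = F.mrk v)) ∨
  (F.S ≤ u ∧ (F.pos u % 2 = 0 ∧ v = F.mrk u ∨ F.pos u % 2 = 1 ∧ v = F.grp u)) ∨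
  (F.S ≤ u ∧ F.pos u ≠ 5 ∧ v = u + 1) ∨
  (F.S ≤ u ∧ F.pos u = 5 ∧ v = 0) ∨
  (u = 0 ∧ F.S ≤ v ∧ F.pos v = 0 ∧ F.Active (F.gad v))

/-- The conditions on the data. -/
structure Good (F : Frame) : Prop where
  q_pos : 0 < F.q
  le_L : 2 ^ F.q ≤ F.L
  var_lt : ∀ j < F.m, ∀ t < 3, F.var j t / F.q < F.G

/-- The digraph. -/
def graph (F : Frame) : Digraph (Fin F.card) where
  Adj u v := F.Arc u v

variable {F : Frame}

theorem Good.L_pos (h : F.Good) : 0 < F.L := lt_of_lt_of_le (by positivity) h.le_L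

theorem Good.two_le_L (h : F.Good) : 2 ≤ F.L :=
  le_trans (by simpa using Nat.pow_le_pow_right (n := 2) (by omega) h.q_pos) h.le_L

theorem card_pos : 0 < F.card := by unfold card S; omega

theorem val_lt (h : F.Good) (c t : ℕ) : F.val c t < F.L := by
  unfold val
  split_ifs <;> exact Nat.mod_lt _ h.L_pos

theorem gad_lt {u : ℕ} (hu : u < F.card) (hS : F.S ≤ u) : F.gad u < F.gadgets := by
  unfold gad
  unfold card at hu
  omega

theorem cl_lt (h : F.Good) {c : ℕ} (hc : c < F.gadgets) : F.cl c < F.m := by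
  have := h.L_pos
  exact (Nat.div_lt_iff_lt_mul (by positivity)).mpr hc

theorem pos_lt (u : ℕ) : F.pos u < 6 := Nat.mod_lt _ (by omega)

theorem grp_lt (h : F.Good) {u : ℕ} (hu : u < F.card) (hS : F.S ≤ u) : F.grp u < F.S := by
  have := h.var_lt _ (cl_lt h (gad_lt hu hS)) (F.pos u / 2) (by have := F.pos_lt u; omega)
  unfold grp S
  omega

theorem le_grp (u : ℕ) : F.L + 2 ≤ F.grp u := Nat.le_add_right _ _

theorem mrk_le (h : F.Good) (u : ℕ) : F.mrk u ≤ F.L + 1 := by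
  have := val_lt h (F.gad u) (F.pos u / 2)
  unfold mrk
  omega

theorem one_le_mrk (u : ℕ) : 1 ≤ F.mrk u := by unfold mrk; omega

theorem le_S : F.L + 2 ≤ F.S := Nat.le_add_right _ _

/-- The number of the gadget has the lowest three digits `a 0`, `a 1`, `a 2` in base `L`, and `j` as
its remaining leading part. -/
theorem exists_gadget (h : F.Good) {j : ℕ} (hj : j < F.m) (a : ℕ → ℕ) (ha : ∀ t < 3, a t < F.L) :
    ∃ c < F.gadgets, F.cl c = j ∧ ∀ t < 3, F.val c t = a t := by
  have hL := h.L_pos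
  have h0 := ha 0 (by omega)
  have h1 := ha 1 (by omega)
  have h2 := ha 2 (by omega)
  have hdiv : ∀ x y, x < F.L → (x + F.L * y) / F.L = y := fun x y hx => by
    rw [Nat.add_mul_div_left _ _ hL, Nat.div_eq_of_lt hx, Nat.zero_add]
  have hmod : ∀ x y, x < F.L → (x + F.L * y) % F.L = x := fun x y hx => by
    rw [Nat.add_mul_mod_self_left, Nat.mod_eq_of_lt hx]
  have hc : F.cl (a 0 + F.L * (a 1 + F.L * (a 2 + F.L * j))) = j := by
    unfold cl
    rw [← Nat.div_div_eq_div_mul, ← Nat.div_div_eq_div_mul, hdiv _ _ h0, hdiv _ _ h1,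
      hdiv _ _ h2]
  refine ⟨a 0 + F.L * (a 1 + F.L * (a 2 + F.L * j)), ?_, hc, ?_⟩
  · unfold gadgets
    rw [← Nat.div_lt_iff_lt_mul (by positivity)]
    unfold cl at hc
    rwa [hc]
  · intro t ht
    unfold val
    interval_cases t
    · simp [hmod _ _ h0]
    · simp [hdiv _ _ h0, hmod _ _ h1]
    · rw [← Nat.div_div_eq_div_mul, hdiv _ _ h0, hdiv _ _ h1]
      simp [hmod _ _ h2]

theorem exists_bits (q : ℕ) (b : ℕ → ℕ) (hb : ∀ x, b x < 2) :
    ∃ a < 2 ^ q, ∀ e < q, bit a e = b e := by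
  induction q generalizing b with
  | zero => exact ⟨0, by simp, fun e he => absurd he (by omega)⟩
  | succ q ih =>
    obtain ⟨a, ha, hae⟩ := ih (fun x => b (x + 1)) fun x => hb _
    have h0 := hb 0
    refine ⟨b 0 + 2 * a, by rw [pow_succ]; omega, fun e he => ?_⟩
    rcases e with _ | e
    · unfold bit
      rw [pow_zero, Nat.div_one]
      omega
    · rw [← hae e (by omega)]
      unfold bit
      rw [pow_succ', ← Nat.div_div_eq_div_mul]
      congr 2
      omega

/-- A digraph with a good colouring comes from a satisfiable formula. -/
theorem sat_of_isColorable (h : F.Good) (hc : IsColorable F.graph 2) : F.Sat := by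
  classical
  obtain ⟨c, hc⟩ := hc
  have hL2 := h.two_le_L
  have hLS := F.le_S
  have hSc : F.S ≤ F.card := Nat.le_add_right _ _
  have h3 : ∀ a b c : Fin 2, a ≠ c → b ≠ c → a = b := by decide
  set col : ℕ → Fin 2 := fun u => if h : u < F.card then c ⟨u, h⟩ else 0 with hcol
  have hcolc : ∀ u (hu : u < F.card), c ⟨u, hu⟩ = col u := fun u hu => by
    simp only [hcol]
    rw [dif_pos hu]
  -- The arcs inside colour class `i`, as a relation on plain numbers, so that the cycles below can
  -- be written without subtypes.
  set R : Fin 2 → ℕ → ℕ → Prop := fun i u v =>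
    (u < F.card ∧ col u = i) ∧ (v < F.card ∧ col v = i) ∧ F.Arc u v with hR
  have hR1 : ∀ i u v, Relation.TransGen (R i) u v → ∀ (hu : u < F.card) (hv : v < F.card)
      (hu' : c ⟨u, hu⟩ = i) (hv' : c ⟨v, hv⟩ = i),
      Relation.TransGen (induce F.graph {v | c v = i}).Adj ⟨⟨u, hu⟩, hu'⟩ ⟨⟨v, hv⟩, hv'⟩ := by
    intro i u v huv
    induction huv with
    | single h1 =>
      intro hu hv hu' hv'
      exact Relation.TransGen.single h1.2.2
    | tail _ h1 ih =>
      intro hu hv hu' hv'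
      obtain ⟨⟨hw, hw'⟩, -, harc⟩ := h1
      have hw'' : c ⟨_, hw⟩ = i := (hcolc _ hw).trans hw'
      exact (ih hu hw hu' hw'').tail harc
  have hac : ∀ i u, ¬ Relation.TransGen (R i) u u := by
    intro i u hu
    have h1 : u < F.card ∧ col u = i := by
      cases hu with
      | single h => exact h.1
      | tail _ h => exact h.2.1
    have h2 : c ⟨u, h1.1⟩ = i := (hcolc _ h1.1).trans h1.2
    exact hc i _ (hR1 i u u hu h1.1 h1.1 h2 h2)
  -- Opposite arcs to the hub force the other base vertices to avoid its colour, and only one colour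
  -- is left.
  have hbase : ∀ u, 1 ≤ u → u < F.S → col u = col 1 := by
    have : ∀ u, 1 ≤ u → u < F.S → col u ≠ col 0 := by
      intro u hu hu' he
      have h1 : R (col 0) 0 u := ⟨⟨card_pos, rfl⟩, ⟨by omega, he⟩, Or.inl ⟨rfl, hu, hu'⟩⟩
      have h2 : R (col 0) u 0 := ⟨⟨by omega, he⟩, ⟨card_pos, rfl⟩,
        Or.inr (Or.inl ⟨rfl, hu, hu'⟩)⟩
      exact hac _ _ ((Relation.TransGen.single h1).tail h2)
    intro u hu hu'
    exact h3 _ _ _ (this u hu hu') (this 1 le_rfl (by omega))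
  have hbase0 : col 1 ≠ col 0 := by
    intro he
    have h1 : R (col 0) 0 1 := ⟨⟨card_pos, rfl⟩, ⟨by omega, he⟩,
      Or.inl ⟨rfl, le_rfl, by omega⟩⟩
    have h2 : R (col 0) 1 0 := ⟨⟨by omega, he⟩, ⟨card_pos, rfl⟩,
      Or.inr (Or.inl ⟨rfl, le_rfl, by omega⟩)⟩
    exact hac _ _ ((Relation.TransGen.single h1).tail h2)
  refine ⟨fun hb => ?_, ?_⟩
  -- With an empty clause, markers `1` and `2` form a directed 2-cycle in the base colour.
  · have h1 : R (col 1) 1 2 := ⟨⟨by omega, rfl⟩, ⟨by omega, hbase 2 (by omega) (by omega)⟩,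
      Or.inr (Or.inr (Or.inr (Or.inr (Or.inl ⟨hb, Or.inl ⟨rfl, rfl⟩⟩))))⟩
    have h2 : R (col 1) 2 1 := ⟨⟨by omega, hbase 2 (by omega) (by omega)⟩, ⟨by omega, rfl⟩,
      Or.inr (Or.inr (Or.inr (Or.inr (Or.inl ⟨hb, Or.inr ⟨rfl, rfl⟩⟩))))⟩
    exact hac _ _ ((Relation.TransGen.single h1).tail h2)
  -- The value of group `i`: the marker with index `0` reaches the group vertex, while the one with
  -- index `L` does not, as the arc back to it would close a cycle. So reachability is lost between
  -- some consecutive markers; it need not be monotone in the index.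
  have hval : ∀ i, ∃ a, i < F.G → a < F.L ∧
      Relation.TransGen (R (col 1)) (1 + a) (F.L + 2 + i) ∧
      ¬ Relation.TransGen (R (col 1)) (1 + (a + 1)) (F.L + 2 + i) := by
    intro i
    by_cases hi : i < F.G
    · have hgS : F.L + 2 + i < F.S := by unfold S; omega
      have hg : F.L + 2 + i < F.card ∧ col (F.L + 2 + i) = col 1 :=
        ⟨by omega, hbase _ (by omega) hgS⟩
      have h0 : Relation.TransGen (R (col 1)) (1 + 0) (F.L + 2 + i) :=
        Relation.TransGen.single ⟨⟨by omega, rfl⟩, hg,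
          Or.inr (Or.inr (Or.inl ⟨rfl, by omega, hgS⟩))⟩
      have hLL : ¬ Relation.TransGen (R (col 1)) (1 + F.L) (F.L + 2 + i) := by
        intro ht
        refine hac _ _ (ht.tail ⟨hg, ⟨by omega, hbase _ (by omega) (by omega)⟩, ?_⟩)
        exact Or.inr (Or.inr (Or.inr (Or.inl ⟨by omega, by omega, hgS⟩)))
      have hex : ∃ a, ¬ Relation.TransGen (R (col 1)) (1 + a) (F.L + 2 + i) := ⟨_, hLL⟩
      have hpos : Nat.find hex ≠ 0 := fun he => Nat.find_spec hex (by rw [he]; exact h0)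
      obtain ⟨a, ha⟩ := Nat.exists_eq_succ_of_ne_zero hpos
      have hle : Nat.find hex ≤ F.L := Nat.find_min' hex hLL
      refine ⟨a, fun _ => ⟨by omega, ?_, ?_⟩⟩
      · exact not_not.mp (Nat.find_min hex (m := a) (by omega))
      · have := Nat.find_spec hex
        rwa [ha] at this
    · exact ⟨0, fun h => absurd h hi⟩
  choose val hval using hval
  refine ⟨fun x => bit (val (x / F.q)) (x % F.q), fun x => Nat.mod_lt _ (by omega), ?_⟩
  intro j hj
  by_contra hno
  push Not at hno
  -- If clause `j` fails, the gadget that supposes the values read off is active.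
  obtain ⟨g, hg, hgj, hga⟩ := exists_gadget h hj (fun t => val (F.var j t / F.q))
    fun t ht => (hval _ (h.var_lt j hj t ht)).1
  have hact : F.Active g := by
    intro t ht
    rw [hgj, hga t ht]
    exact hno t ht
  have hpos : ∀ s < 6, F.pos (F.S + 6 * g + s) = s := by
    intro s hs
    unfold pos
    omega
  have hgad : ∀ s < 6, F.gad (F.S + 6 * g + s) = g := by
    intro s hs
    unfold gad
    omega
  have hz : ∀ s < 6, F.S + 6 * g + s < F.card := by
    intro s hs
    unfold card
    omega
  -- Otherwise all six vertices have the hub's colour, and together with the hub they form a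
  -- monochromatic cycle.
  have hex : ∃ s < 6, col (F.S + 6 * g + s) = col 1 := by
    by_contra hne
    push Not at hne
    have hcz : ∀ s < 6, col (F.S + 6 * g + s) = col 0 := fun s hs =>
      h3 _ _ (col 1) (hne s hs) hbase0.symm
    have h0 : R (col 0) 0 (F.S + 6 * g + 0) := by
      refine ⟨⟨card_pos, rfl⟩, ⟨hz 0 (by omega), hcz 0 (by omega)⟩, ?_⟩
      refine Or.inr (Or.inr (Or.inr (Or.inr (Or.inr (Or.inr (Or.inr (Or.inr (Or.inr
        ⟨rfl, by omega, hpos 0 (by omega), ?_⟩))))))))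
      rw [hgad 0 (by omega)]
      exact hact
    have hs : ∀ s < 5, R (col 0) (F.S + 6 * g + s) (F.S + 6 * g + (s + 1)) := by
      intro s hs
      refine ⟨⟨hz s (by omega), hcz s (by omega)⟩, ⟨hz _ (by omega), hcz _ (by omega)⟩, ?_⟩
      refine Or.inr (Or.inr (Or.inr (Or.inr (Or.inr (Or.inr (Or.inr (Or.inl
        ⟨by omega, ?_, rfl⟩)))))))
      rw [hpos s (by omega)]
      omega
    have h5 : R (col 0) (F.S + 6 * g + 5) 0 := by
      refine ⟨⟨hz 5 (by omega), hcz 5 (by omega)⟩, ⟨card_pos, rfl⟩, ?_⟩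
      exact Or.inr (Or.inr (Or.inr (Or.inr (Or.inr (Or.inr (Or.inr (Or.inr (Or.inl
        ⟨by omega, hpos 5 (by omega), rfl⟩))))))))
    exact hac _ _ (((((((Relation.TransGen.single h0).tail (hs 0 (by omega))).tail
      (hs 1 (by omega))).tail (hs 2 (by omega))).tail (hs 3 (by omega))).tail
      (hs 4 (by omega))).tail h5)
  obtain ⟨s, hs, hcs⟩ := hex
  have hp := hpos s hs
  have hgS := grp_lt h (hz s hs) (by omega)
  have hLg := F.le_grp (F.S + 6 * g + s)
  have hmL := mrk_le h (F.S + 6 * g + s)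
  have h1m := F.one_le_mrk (F.S + 6 * g + s)
  have hzR : F.S + 6 * g + s < F.card ∧ col (F.S + 6 * g + s) = col 1 := ⟨hz s hs, hcs⟩
  have hgR : F.grp (F.S + 6 * g + s) < F.card ∧ col (F.grp (F.S + 6 * g + s)) = col 1 :=
    ⟨by omega, hbase _ (by omega) hgS⟩
  have hmR : F.mrk (F.S + 6 * g + s) < F.card ∧ col (F.mrk (F.S + 6 * g + s)) = col 1 :=
    ⟨by omega, hbase _ h1m (by omega)⟩
  obtain ⟨-, hv1, hv2⟩ := hval _ (h.var_lt j hj (s / 2) (by omega))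
  have hgeq : F.grp (F.S + 6 * g + s) = F.L + 2 + F.var j (s / 2) / F.q := by
    unfold grp
    rw [hp, hgad s hs, hgj]
  have hmeq : F.mrk (F.S + 6 * g + s) = 1 + val (F.var j (s / 2) / F.q) + s % 2 := by
    unfold mrk
    rw [hp, hgad s hs, hga _ (by omega)]
  rcases Nat.mod_two_eq_zero_or_one s with he | ho
  -- Even position: the marker of the value reaches the group vertex, and the gadget vertex leads
  -- from there back to the marker.
  · have h1 : R (col 1) (F.grp (F.S + 6 * g + s)) (F.S + 6 * g + s) := ⟨hgR, hzR,
      Or.inr (Or.inr (Or.inr (Or.inr (Or.inr (Or.inl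
        ⟨by omega, Or.inl ⟨by rw [hp, he], rfl⟩⟩)))))⟩
    have h2 : R (col 1) (F.S + 6 * g + s) (F.mrk (F.S + 6 * g + s)) := ⟨hzR, hmR,
      Or.inr (Or.inr (Or.inr (Or.inr (Or.inr (Or.inr (Or.inl
        ⟨by omega, Or.inl ⟨by rw [hp, he], rfl⟩⟩))))))⟩
    rw [he, Nat.add_zero] at hmeq
    rw [← hgeq, ← hmeq] at hv1
    exact hac _ _ ((hv1.tail h1).tail h2)
  -- Odd position: the gadget vertex lets the next marker reach the group vertex, contrary to the
  -- choice of the value.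
  · have h1 : R (col 1) (F.mrk (F.S + 6 * g + s)) (F.S + 6 * g + s) := ⟨hmR, hzR,
      Or.inr (Or.inr (Or.inr (Or.inr (Or.inr (Or.inl
        ⟨by omega, Or.inr ⟨by rw [hp, ho], rfl⟩⟩)))))⟩
    have h2 : R (col 1) (F.S + 6 * g + s) (F.grp (F.S + 6 * g + s)) := ⟨hzR, hgR,
      Or.inr (Or.inr (Or.inr (Or.inr (Or.inr (Or.inr (Or.inl
        ⟨by omega, Or.inr ⟨by rw [hp, ho], rfl⟩⟩))))))⟩
    rw [ho, Nat.add_assoc 1] at hmeq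
    rw [← hgeq, ← hmeq] at hv2
    exact hv2 ((Relation.TransGen.single h1).tail h2)

end Frame
end DiColoring

/-! ### Colourings from satisfying assignments, and the treedepth of the digraph. -/

namespace DiColoring
namespace Frame

variable {F : Frame}

/-- The digraph of a satisfiable formula has a good colouring. -/
theorem isColorable_of_sat (h : F.Good) (hs : F.Sat) : IsColorable F.graph 2 := by
  classical
  obtain ⟨hnb, b, hb, hsat⟩ := hs
  have hL2 := h.two_le_L
  have hLS := F.le_S
  have hval : ∀ i, ∃ a < 2 ^ F.q, ∀ e < F.q, bit a e = b (i * F.q + e) := fun i =>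
    exists_bits F.q (fun e => b (i * F.q + e)) fun _ => hb _
  choose v hvL hv using hval
  have hvb : ∀ x, bit (v (x / F.q)) (x % F.q) = b x := fun x => by
    rw [hv _ _ (Nat.mod_lt _ h.q_pos), Nat.div_add_mod']
  have hvL : ∀ i, v i < F.L := fun i => (hvL i).trans_le h.le_L
  -- Under the values supposed by an active gadget all literals fail, but the assignment satisfies
  -- the `t`-th, say. So the true value of that group differs from the supposed one: position `2 *
  -- t` is chosen if it is smaller, `2 * t + 1` if it is larger. For other `c` the default `0` plays
  -- no role.
  have hs0 : ∀ c, ∃ s, c < F.gadgets → F.Active c → s < 6 ∧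
      (s % 2 = 0 → v (F.var (F.cl c) (s / 2) / F.q) < F.val c (s / 2)) ∧
      (s % 2 = 1 → F.val c (s / 2) < v (F.var (F.cl c) (s / 2) / F.q)) := by
    intro c
    by_cases hc : c < F.gadgets ∧ F.Active c
    · obtain ⟨hc, hact⟩ := hc
      obtain ⟨t, ht, hbt⟩ := hsat _ (cl_lt h hc)
      have hne : v (F.var (F.cl c) t / F.q) ≠ F.val c t := by
        intro he
        apply hact t ht
        rw [← he, hvb, hbt]
      rcases lt_or_gt_of_ne hne with hlt | hgt
      · refine ⟨2 * t, fun _ _ => ⟨by omega, fun _ => ?_, fun _ => by omega⟩⟩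
        rwa [show 2 * t / 2 = t by omega]
      · refine ⟨2 * t + 1, fun _ _ => ⟨by omega, fun _ => by omega, fun _ => ?_⟩⟩
        rwa [show (2 * t + 1) / 2 = t by omega]
    · exact ⟨0, fun h1 h2 => absurd ⟨h1, h2⟩ hc⟩
  choose s₀ hs₀ using hs0
  -- The base colour class: all base vertices except the hub, and one vertex of each active gadget,
  -- which cuts its cycle through the hub.
  set A : ℕ → Prop := fun u => (1 ≤ u ∧ u < F.S) ∨
    (F.S ≤ u ∧ F.Active (F.gad u) ∧ F.pos u = s₀ (F.gad u)) with hA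
  -- Markers have ranks divisible by `4`. A group vertex lies between the marker of its value and
  -- the next one, at residue `2`. This leaves residue `3` for a gadget vertex entered from the
  -- group and residue `1` for one leading to it.
  set ρ₀ : ℕ → ℕ := fun u => if u ≤ F.L + 1 then 4 * (u - 1) else if u < F.S then
    4 * v (u - (F.L + 2)) + 2 else if F.pos u % 2 = 0 then 4 * v (F.grp u - (F.L + 2)) + 3 else
    4 * v (F.grp u - (F.L + 2)) + 1 with hρ₀
  -- The hub has rank `10`. In an active gadget the part of the path before the chosen vertex comes
  -- after the hub and the part behind it comes before the hub. An inactive gadget has no arc from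
  -- the hub and comes before it entirely.
  set ρ₁ : ℕ → ℕ := fun u => if u = 0 then 10 else
    if F.Active (F.gad u) ∧ F.pos u < s₀ (F.gad u) then 11 + F.pos u else F.pos u with hρ₁
  have hgrp : ∀ u, F.grp u - (F.L + 2) = F.var (F.cl (F.gad u)) (F.pos u / 2) / F.q := fun u => by
    exact Nat.add_sub_cancel_left _ _
  have hnext : ∀ u, F.S ≤ u → F.pos u ≠ 5 →
      F.gad (u + 1) = F.gad u ∧ F.pos (u + 1) = F.pos u + 1 := by
    intro u hu hp
    unfold pos gad at *
    omega
  have hρ₀m : ∀ u, ρ₀ (F.mrk u) = 4 * (F.val (F.gad u) (F.pos u / 2) + F.pos u % 2) := by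
    intro u
    simp only [hρ₀]
    rw [if_pos (mrk_le h u)]
    unfold mrk
    omega
  have hρ₀g : ∀ u, u < F.card → F.S ≤ u →
      ρ₀ (F.grp u) = 4 * v (F.grp u - (F.L + 2)) + 2 := by
    intro u hu hS
    simp only [hρ₀]
    have h1 := F.le_grp u
    rw [if_neg (by omega), if_pos (grp_lt h hu hS)]
  have hA0 : ∀ u w, u < F.card → w < F.card → A u → A w → F.Arc u w → ρ₀ u < ρ₀ w := by
    intro u w hu hw hAu hAw harc
    rcases harc with ⟨rfl, h1⟩ | ⟨rfl, h1⟩ | ⟨rfl, h1, h2⟩ | ⟨rfl, h1, h2⟩ | ⟨hbr, _⟩ | ⟨h1, h2⟩ |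
      ⟨h1, h2⟩ | ⟨h1, h2, rfl⟩ | ⟨h1, h2, rfl⟩ | ⟨rfl, h1⟩
    · simp only [hA] at hAu
      omega
    · simp only [hA] at hAw
      omega
    · simp only [hρ₀]
      rw [if_pos (by omega), if_neg (by omega), if_pos h2]
      omega
    · simp only [hρ₀]
      rw [if_neg (by omega), if_pos h2, if_pos (by omega)]
      have := hvL (u - (F.L + 2))
      omega
    · exact absurd hbr hnb
    · have hAw' : F.Active (F.gad w) ∧ F.pos w = s₀ (F.gad w) := by
        simp only [hA] at hAw
        rcases hAw with hAw | hAw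
        · omega
        · exact hAw.2
      obtain ⟨-, he, ho⟩ := hs₀ _ (gad_lt hw h1) hAw'.1
      rw [← hAw'.2, ← hgrp] at he ho
      have hw1 : ¬ w ≤ F.L + 1 := by omega
      have hw2 : ¬ w < F.S := by omega
      rcases h2 with ⟨h2, rfl⟩ | ⟨h2, rfl⟩
      · rw [hρ₀g w hw h1]
        simp only [hρ₀]
        rw [if_neg hw1, if_neg hw2, if_pos h2]
        omega
      · rw [hρ₀m]
        simp only [hρ₀]
        rw [if_neg hw1, if_neg hw2, if_neg (by omega)]
        have := ho h2
        omega
    · have hAw' : F.Active (F.gad u) ∧ F.pos u = s₀ (F.gad u) := by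
        simp only [hA] at hAu
        rcases hAu with hAu | hAu
        · omega
        · exact hAu.2
      obtain ⟨-, he, ho⟩ := hs₀ _ (gad_lt hu h1) hAw'.1
      rw [← hAw'.2, ← hgrp] at he ho
      have hw1 : ¬ u ≤ F.L + 1 := by omega
      have hw2 : ¬ u < F.S := by omega
      rcases h2 with ⟨h2, rfl⟩ | ⟨h2, rfl⟩
      · rw [hρ₀m]
        simp only [hρ₀]
        rw [if_neg hw1, if_neg hw2, if_pos h2]
        have := he h2
        omega
      · rw [hρ₀g u hu h1]
        simp only [hρ₀]
        rw [if_neg hw1, if_neg hw2, if_neg (by omega)]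
        omega
    · obtain ⟨h3, h4⟩ := hnext u h1 h2
      simp only [hA, h3, h4] at hAu hAw
      omega
    · simp only [hA] at hAw
      omega
    · simp only [hA] at hAu
      omega
  have hA1 : ∀ u w, u < F.card → w < F.card → ¬ A u → ¬ A w → F.Arc u w → ρ₁ u < ρ₁ w := by
    intro u w hu hw hAu hAw harc
    simp only [hA] at hAu hAw
    rcases harc with ⟨rfl, h1⟩ | ⟨rfl, h1⟩ | ⟨rfl, h1, h2⟩ | ⟨rfl, h1, h2⟩ | ⟨hbr, _⟩ | ⟨h1, h2⟩ |
      ⟨h1, h2⟩ | ⟨h1, h2, rfl⟩ | ⟨h1, h2, rfl⟩ | ⟨rfl, h1, h2, h3⟩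
    · exact absurd (Or.inl h1) hAw
    · exact absurd (Or.inl h1) hAu
    · omega
    · omega
    · exact absurd hbr hnb
    · have h3 := grp_lt h hw h1
      have h4 := F.le_grp w
      have h5 := mrk_le h w
      have h6 := F.one_le_mrk w
      omega
    · have h3 := grp_lt h hu h1
      have h4 := F.le_grp u
      have h5 := mrk_le h u
      have h6 := F.one_le_mrk u
      omega
    · obtain ⟨h3, h4⟩ := hnext u h1 h2
      rw [h3, h4] at hAw
      simp only [hρ₁]
      rw [if_neg (show ¬ u = 0 by omega), if_neg (show ¬ u + 1 = 0 by omega), h3, h4]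
      by_cases hact : F.Active (F.gad u)
      · have h5 : F.pos u ≠ s₀ (F.gad u) := fun he => hAu (Or.inr ⟨h1, hact, he⟩)
        have h6 : F.pos u + 1 ≠ s₀ (F.gad u) := fun he => hAw (Or.inr ⟨by omega, hact, he⟩)
        simp only [hact, true_and]
        split_ifs <;> omega
      · simp only [hact, false_and, if_false]
        omega
    · simp only [hρ₁, if_true]
      rw [if_neg (by omega), if_neg]
      · omega
      · rintro ⟨hact, hlt⟩
        have := (hs₀ _ (gad_lt hu h1) hact).1
        omega
    · simp only [hρ₁, if_true]
      have h4 : F.pos w ≠ s₀ (F.gad w) := fun he => hAw (Or.inr ⟨h1, h3, he⟩)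
      rw [if_neg (by omega), if_pos ⟨h3, by omega⟩]
      omega
  refine ⟨fun u => if A u then 0 else 1, fun i => ?_⟩
  by_cases hi : i = 0
  · subst hi
    refine isAcyclic_of_rank (fun u => ρ₀ u.1.1) fun u w huw => ?_
    refine hA0 _ _ u.1.2 w.1.2 ?_ ?_ huw
    · by_contra hn
      have := u.2
      simp [hn] at this
    · by_contra hn
      have := w.2
      simp [hn] at this
  · refine isAcyclic_of_rank (fun u => ρ₁ u.1.1) fun u w huw => ?_
    refine hA1 _ _ u.1.2 w.1.2 ?_ ?_ huw
    · intro hn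
      have := u.2
      simp only [Set.mem_ofPred_eq, hn, if_true] at this
      exact hi this.symm
    · intro hn
      have := w.2
      simp only [Set.mem_ofPred_eq, hn, if_true] at this
      exact hi this.symm

theorem isColorable_iff (h : F.Good) : IsColorable F.graph 2 ↔ F.Sat :=
  ⟨sat_of_isColorable h, isColorable_of_sat h⟩

/-- Deleting the base costs `S` and leaves only gadgets, which are blocks of six vertices without
arcs between different blocks. -/
theorem treedepth_graph_le (h : F.Good) :
    treedepth F.graph.toSimpleGraphInclusive ≤ F.S + 6 := by
  classical
  have hLS := F.le_S
  have harc : ∀ u w, u < F.card → w < F.card → F.S ≤ u → F.S ≤ w → F.Arc u w →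
      F.gad u = F.gad w := by
    intro u w hu hw hSu hSw harc
    rcases harc with h1 | h1 | h1 | h1 | h1 | ⟨h1, h2⟩ | ⟨h1, h2⟩ | ⟨h1, h2, rfl⟩ | h1 | h1
    · omega
    · omega
    · omega
    · omega
    · omega
    · have h3 := grp_lt h hw h1
      have h5 := mrk_le h w
      omega
    · have h3 := grp_lt h hu h1
      have h5 := mrk_le h u
      omega
    · unfold pos at h2
      unfold gad
      omega
    · omega
    · omega
  set T : Set (Fin F.card) := {u | F.S ≤ u.1} with hT
  have hTd : HasTreedepthLE F.graph.toSimpleGraphInclusive T 6 := by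
    refine hasTreedepthLE_of_blocks (fun u => F.gad u.1) ?_ ?_
    · intro u hu w hw hadj
      rw [Digraph.toSimpleGraphInclusive, SimpleGraph.fromRel_adj] at hadj
      rcases hadj.2 with h1 | h1
      · exact harc _ _ u.2 w.2 hu hw h1
      · exact (harc _ _ w.2 u.2 hw hu h1).symm
    · intro i
      have h1 : Set.MapsTo (fun u : Fin F.card => F.pos u.1) {u ∈ T | F.gad u.1 = i}
          (Finset.range 6 : Set ℕ) := fun u _ => by
        simpa using F.pos_lt u.1
      have h2 : Set.InjOn (fun u : Fin F.card => F.pos u.1) {u ∈ T | F.gad u.1 = i} := by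
        rintro u ⟨hu, hui⟩ w ⟨hw, hwi⟩ he
        simp only [hT, Set.mem_ofPred_eq] at hu hw
        have he : F.pos u.1 = F.pos w.1 := he
        unfold pos at he
        unfold gad at hui hwi
        exact Fin.ext (by omega)
      refine (Set.encard_le_encard_of_injOn h1 h2).trans ?_
      rw [Set.encard_coe_eq_coe_finsetCard, Finset.card_range]
  set X : Finset (Fin F.card) := Finset.univ.filter fun u => u.1 < F.S with hX
  have hXT : ∀ u ∈ X, u ∉ T := by
    intro u hu
    simp only [hX, Finset.mem_filter] at hu
    simp only [hT, Set.mem_ofPred_eq]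
    omega
  have hun : T ∪ X = Set.univ := by
    ext u
    simp only [hT, hX, Set.mem_union, Set.mem_ofPred_eq, Finset.coe_filter, Finset.mem_univ,
      true_and, Set.mem_univ, iff_true]
    omega
  have hXc : X.card ≤ F.S := by
    have := Finset.card_le_card_of_injOn (s := X) (t := Finset.range F.S) (fun u => u.1)
      (fun u hu => by simpa [hX] using hu) (fun u _ w _ he => Fin.ext he)
    rwa [Finset.card_range] at this
  have h1 := hTd.union X hXT
  rw [hun] at h1
  refine (Nat.sInf_le h1).trans ?_
  omega

/-- The digraph as an instance of the colouring problem. -/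
def toInstance (F : Frame) (h : F.Good) : DigraphInstance where
  n := F.card
  n_pos := card_pos
  graph := F.graph
  loopless := by
    intro u harc
    have hLS := F.le_S
    rcases harc with h1 | h1 | h1 | h1 | h1 | ⟨h1, h2⟩ | ⟨h1, h2⟩ | h1 | h1 | h1
    · omega
    · omega
    · omega
    · omega
    · omega
    · have h3 := grp_lt h u.2 h1
      have h5 := mrk_le h u
      omega
    · have h3 := grp_lt h u.2 h1
      have h5 := mrk_le h u
      omega
    · omega
    · omega
    · omega

end Frame
end DiColoring

namespace DiColoring

/-! ### The reduction -/

/-- The data read from the string of a formula. Clauses are padded by repeating the last literal. -/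
def frameOf (w : List Bool) : Frame where
  m := Scan.numClauses w
  q := Nat.log 2 (Scan.numVars w + Scan.numClauses w) / 2 + 1
  L := 2 ^ (Nat.log 2 (Scan.numVars w + Scan.numClauses w) / 2 + 1)
  G := (Scan.numVars w + Scan.numClauses w) /
    (Nat.log 2 (Scan.numVars w + Scan.numClauses w) / 2 + 1) + 1
  broken := ∃ j < Scan.numClauses w, Scan.clauseLen w j = 0
  var j t := min (Scan.litVar w j (min t (Scan.clauseLen w j - 1)))
    (Scan.numVars w + Scan.numClauses w)
  sgn j t := Scan.litSign w j (min t (Scan.clauseLen w j - 1))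

/-- The truncation of variable indices in `frameOf` makes the bound on groups hold for arbitrary
strings, also those that are not codes. -/
theorem good_frameOf (w : List Bool) : (frameOf w).Good where
  q_pos := Nat.succ_pos _
  le_L := le_rfl
  var_lt _ _ _ _ := Nat.lt_succ_of_le (Nat.div_le_div_right (min_le_right _ _))

/-- On codes the truncation of indices has no effect. Repeating the last literal does not change the
truth of a nonempty clause, and an empty clause makes the frame `broken`. -/
theorem sat_frameOf (φ : ThreeCNF) : (frameOf φ.encode).Sat ↔ φ.Satisfiable := by
  have hm : Scan.numClauses φ.encode = φ.clauses.length := Scan.numClauses_encode φ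
  have hvar : ∀ j (hj : j < φ.clauses.length) t (ht : t < φ.clauses[j].length),
      (frameOf φ.encode).var j t = (φ.clauses[j][t]).1 ∧
      (frameOf φ.encode).sgn j t = if (φ.clauses[j][t]).2 then 1 else 0 := by
    intro j hj t ht
    simp only [frameOf]
    have ht' : min t (φ.clauses[j].length - 1) = t := Nat.min_eq_left (by omega)
    rw [Scan.clauseLen_encode hj, ht', Scan.litVar_encode hj ht,
      Scan.litSign_encode hj ht, Scan.numVars_encode]
    exact ⟨Nat.min_eq_left (by omega), rfl⟩
  have hpad : ∀ j (hj : j < φ.clauses.length) t,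
      (frameOf φ.encode).var j t = (frameOf φ.encode).var j (min t (φ.clauses[j].length - 1)) ∧
      (frameOf φ.encode).sgn j t = (frameOf φ.encode).sgn j (min t (φ.clauses[j].length - 1)) := by
    intro j hj t
    simp only [frameOf]
    rw [Scan.clauseLen_encode hj, Nat.min_assoc, Nat.min_self]
    exact ⟨rfl, rfl⟩
  constructor
  · rintro ⟨hbr, b, hb, hsat⟩
    refine ⟨fun x => b x == 1, fun c hc => ?_⟩
    obtain ⟨j, hj, rfl⟩ := List.getElem_of_mem hc
    have hlen : φ.clauses[j].length ≠ 0 := fun h0 =>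
      hbr ⟨j, hm ▸ hj, (Scan.clauseLen_encode hj).trans h0⟩
    obtain ⟨t, -, hbt⟩ := hsat j (show j < Scan.numClauses φ.encode from hm ▸ hj)
    have hlt : min t (φ.clauses[j].length - 1) < φ.clauses[j].length := by omega
    refine ⟨φ.clauses[j][min t (φ.clauses[j].length - 1)], List.getElem_mem _, ?_⟩
    obtain ⟨h1, h2⟩ := hpad j hj t
    obtain ⟨h3, h4⟩ := hvar j hj _ hlt
    rw [h1, h2, h3, h4] at hbt
    beta_reduce
    rw [hbt]
    cases (φ.clauses[j][min t (φ.clauses[j].length - 1)]).2 <;> rfl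
  · rintro ⟨a, ha⟩
    refine ⟨?_, fun x => if h : x < φ.numVars then (if a ⟨x, h⟩ then 1 else 0) else 0,
      fun x => by beta_reduce; split_ifs <;> omega, ?_⟩
    · rintro ⟨j, hj, h0⟩
      have hj : j < φ.clauses.length := hm ▸ hj
      rw [Scan.clauseLen_encode hj] at h0
      obtain ⟨l, hl, -⟩ := ha _ (List.getElem_mem hj)
      rw [List.length_eq_zero_iff.mp h0] at hl
      exact absurd hl (by simp)
    · intro j hj
      have hj : j < φ.clauses.length := hm ▸ hj
      obtain ⟨l, hl, hal⟩ := ha _ (List.getElem_mem hj)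
      obtain ⟨t, ht, rfl⟩ := List.getElem_of_mem hl
      have h3 := φ.length_le _ (List.getElem_mem hj)
      refine ⟨t, by omega, ?_⟩
      obtain ⟨h1, h2⟩ := hvar j hj t ht
      rw [h1, h2]
      beta_reduce
      rw [dif_pos (φ.clauses[j][t]).1.2]
      simp only [Fin.eta, hal]

/-! ### The reduction in polynomial time -/

section Computable

variable {k : ℕ} {f g : List Bool → (Fin k → ℕ) → ℕ}

open UnaryPoly

theorem unaryPoly_vars_add_clauses :
    UnaryPoly (fun w (_ : Fin k → ℕ) => Scan.numVars w + Scan.numClauses w) :=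
  Scan.unaryPoly_numVars.add Scan.unaryPoly_numClauses

theorem unaryPoly_q : UnaryPoly (fun w (_ : Fin k → ℕ) => (frameOf w).q) :=
  (unaryPoly_vars_add_clauses.log_two.div (const 2)).succ

/-- This linear bound is what allows the power of two to be computed in unary. -/
theorem two_pow_log_div_two_le (N : ℕ) : 2 ^ (Nat.log 2 N / 2 + 1) ≤ 2 * (N + 1) := by
  rw [pow_succ']
  refine Nat.mul_le_mul_left 2 ?_
  rcases Nat.eq_zero_or_pos N with rfl | hN
  · simp
  · exact (Nat.pow_le_pow_right (by omega) (Nat.div_le_self _ _)).trans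
      ((Nat.pow_log_le_self 2 (by omega)).trans (Nat.le_succ N))

theorem unaryPoly_L : UnaryPoly (fun w (_ : Fin k → ℕ) => (frameOf w).L) :=
  unaryPoly_q.two_pow ((const 2).mul unaryPoly_vars_add_clauses.succ)
    fun _ _ => two_pow_log_div_two_le _

theorem unaryPoly_S : UnaryPoly (fun w (_ : Fin k → ℕ) => (frameOf w).S) :=
  unaryPoly_L.succ.succ.add (unaryPoly_vars_add_clauses.div unaryPoly_q).succ

theorem unaryPoly_gadgets : UnaryPoly (fun w (_ : Fin k → ℕ) => (frameOf w).gadgets) :=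
  Scan.unaryPoly_numClauses.mul ((unaryPoly_L.mul unaryPoly_L).mul unaryPoly_L)

theorem unaryPoly_card : UnaryPoly (fun w (_ : Fin k → ℕ) => (frameOf w).card) :=
  unaryPoly_S.add ((const 6).mul unaryPoly_gadgets)

theorem unaryPoly_gad (hf : UnaryPoly f) : UnaryPoly (fun w x => (frameOf w).gad (f w x)) :=
  (hf.sub unaryPoly_S).div (const 6)

theorem unaryPoly_pos (hf : UnaryPoly f) : UnaryPoly (fun w x => (frameOf w).pos (f w x)) :=
  (hf.sub unaryPoly_S).mod (const 6)

theorem unaryPoly_cl (hf : UnaryPoly f) : UnaryPoly (fun w x => (frameOf w).cl (f w x)) :=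
  hf.div ((unaryPoly_L.mul unaryPoly_L).mul unaryPoly_L)

theorem unaryPoly_val (hf : UnaryPoly f) (hg : UnaryPoly g) :
    UnaryPoly (fun w x => (frameOf w).val (f w x) (g w x)) :=
  (UnaryPolyPred.eq_zero hg).ite (hf.mod unaryPoly_L)
    ((UnaryPolyPred.eq hg (const 1)).ite ((hf.div unaryPoly_L).mod unaryPoly_L)
      ((hf.div (unaryPoly_L.mul unaryPoly_L)).mod unaryPoly_L))

/-- The divisor `2 ^ g` may be too large to write down. Cutting it off at `f + 1` is harmless, since
where the cut takes effect both quotients are `0`. -/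
theorem unaryPoly_bit (hf : UnaryPoly f) (hg : UnaryPoly g) :
    UnaryPoly (fun w x => Frame.bit (f w x) (g w x)) :=
  ((hf.div (hg.min_two_pow hf.succ)).mod (const 2)).congr fun w x => by
    unfold Frame.bit
    rcases le_or_gt (2 ^ g w x) (f w x + 1) with h | h
    · rw [Nat.min_eq_left h]
    · rw [Nat.min_eq_right h.le, Nat.div_eq_of_lt (by omega), Nat.div_eq_of_lt (by omega)]

theorem unaryPoly_padded (hf : UnaryPoly f) (hg : UnaryPoly g) :
    UnaryPoly (fun w x => min (g w x) (Scan.clauseLen w (f w x) - 1)) :=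
  hg.min (Scan.unaryPoly_clauseLen hf).pred

theorem unaryPoly_var (hf : UnaryPoly f) (hg : UnaryPoly g) :
    UnaryPoly (fun w x => (frameOf w).var (f w x) (g w x)) :=
  (Scan.unaryPoly_litVar hf (unaryPoly_padded hf hg)).min unaryPoly_vars_add_clauses

theorem unaryPoly_sgn (hf : UnaryPoly f) (hg : UnaryPoly g) :
    UnaryPoly (fun w x => (frameOf w).sgn (f w x) (g w x)) :=
  Scan.unaryPoly_litSign hf (unaryPoly_padded hf hg)

theorem unaryPolyPred_broken :
    UnaryPolyPred (fun w (_ : Fin k → ℕ) => (frameOf w).broken) :=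
  UnaryPolyPred.exists_lt (r := fun w y => Scan.clauseLen w (y 0) = 0) Scan.unaryPoly_numClauses
    (UnaryPolyPred.eq_zero (Scan.unaryPoly_clauseLen (arg 0)))

theorem unaryPolyPred_active (hf : UnaryPoly f) :
    UnaryPolyPred (fun w x => (frameOf w).Active (f w x)) := by
  have h : ∀ t, UnaryPolyPred (fun w x => Frame.bit ((frameOf w).val (f w x) t)
      ((frameOf w).var ((frameOf w).cl (f w x)) t % (frameOf w).q) ≠
      (frameOf w).sgn ((frameOf w).cl (f w x)) t) := fun t =>
    UnaryPolyPred.ne (unaryPoly_bit (unaryPoly_val hf (const t))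
      ((unaryPoly_var (unaryPoly_cl hf) (const t)).mod unaryPoly_q))
      (unaryPoly_sgn (unaryPoly_cl hf) (const t))
  refine ((h 0).and ((h 1).and (h 2))).congr fun w x => ⟨?_, ?_⟩
  · rintro ⟨h0, h1, h2⟩ t ht
    interval_cases t <;> assumption
  · intro h
    exact ⟨h 0 (by omega), h 1 (by omega), h 2 (by omega)⟩

theorem unaryPoly_grp (hf : UnaryPoly f) : UnaryPoly (fun w x => (frameOf w).grp (f w x)) :=
  unaryPoly_L.succ.succ.add ((unaryPoly_var (unaryPoly_cl (unaryPoly_gad hf))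
    ((unaryPoly_pos hf).div (const 2))).div unaryPoly_q)

theorem unaryPoly_mrk (hf : UnaryPoly f) : UnaryPoly (fun w x => (frameOf w).mrk (f w x)) :=
  ((const 1).add (unaryPoly_val (unaryPoly_gad hf) ((unaryPoly_pos hf).div (const 2)))).add
    ((unaryPoly_pos hf).mod (const 2))

theorem unaryPolyPred_arc (hf : UnaryPoly f) (hg : UnaryPoly g) :
    UnaryPolyPred (fun w x => (frameOf w).Arc (f w x) (g w x)) := by
  have eqc : ∀ {f : List Bool → (Fin k → ℕ) → ℕ} (_ : UnaryPoly f) (n : ℕ),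
      UnaryPolyPred (fun w x => f w x = n) := fun hf n => UnaryPolyPred.eq hf (const n)
  have ge1 : ∀ {f : List Bool → (Fin k → ℕ) → ℕ} (_ : UnaryPoly f),
      UnaryPolyPred (fun w x => 1 ≤ f w x ∧ f w x < (frameOf w).S) := fun hf =>
    (UnaryPolyPred.le (const 1) hf).and (UnaryPolyPred.lt hf unaryPoly_S)
  have geL : ∀ {f : List Bool → (Fin k → ℕ) → ℕ} (_ : UnaryPoly f),
      UnaryPolyPred (fun w x => (frameOf w).L + 2 ≤ f w x ∧ f w x < (frameOf w).S) := fun hf =>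
    (UnaryPolyPred.le unaryPoly_L.succ.succ hf).and (UnaryPolyPred.lt hf unaryPoly_S)
  have geS : ∀ {f : List Bool → (Fin k → ℕ) → ℕ} (_ : UnaryPoly f),
      UnaryPolyPred (fun w x => (frameOf w).S ≤ f w x) := fun hf =>
    UnaryPolyPred.le unaryPoly_S hf
  have parity : ∀ n, UnaryPolyPred (fun w x => (frameOf w).pos (g w x) % 2 = n) :=
    fun n => eqc ((unaryPoly_pos hg).mod (const 2)) n
  have parity' : ∀ n, UnaryPolyPred (fun w x => (frameOf w).pos (f w x) % 2 = n) :=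
    fun n => eqc ((unaryPoly_pos hf).mod (const 2)) n
  exact ((eqc hf 0).and (ge1 hg)).or <| ((eqc hg 0).and (ge1 hf)).or <|
    ((eqc hf 1).and (geL hg)).or <| ((UnaryPolyPred.eq hg unaryPoly_L.succ).and (geL hf)).or <|
    (unaryPolyPred_broken.and (((eqc hf 1).and (eqc hg 2)).or ((eqc hf 2).and (eqc hg 1)))).or <|
    ((geS hg).and (((parity 0).and (UnaryPolyPred.eq hf (unaryPoly_grp hg))).or
      ((parity 1).and (UnaryPolyPred.eq hf (unaryPoly_mrk hg))))).or <|
    ((geS hf).and (((parity' 0).and (UnaryPolyPred.eq hg (unaryPoly_mrk hf))).or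
      ((parity' 1).and (UnaryPolyPred.eq hg (unaryPoly_grp hf))))).or <|
    ((geS hf).and ((eqc (unaryPoly_pos hf) 5).not.and (UnaryPolyPred.eq hg hf.succ))).or <|
    ((geS hf).and ((eqc (unaryPoly_pos hf) 5).and (eqc hg 0))).or <|
    (eqc hf 0).and ((geS hg).and ((eqc (unaryPoly_pos hg) 0).and
      (unaryPolyPred_active (unaryPoly_gad hg))))

end Computable

/-- The length of the code of the digraph. -/
def outLength (w : List Bool) : ℕ := (frameOf w).card + (1 + (frameOf w).card * (frameOf w).card)

open Classical in
/-- The bits of the code of the digraph. -/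
noncomputable def outBit (w : List Bool) (i : ℕ) : ℕ :=
  if i < (frameOf w).card then 1 else if i = (frameOf w).card then 0 else
    if (frameOf w).Arc ((i - ((frameOf w).card + 1)) / (frameOf w).card)
      ((i - ((frameOf w).card + 1)) % (frameOf w).card) then 1 else 0

theorem unaryPoly_outLength : UnaryPoly (fun w (_ : Fin 0 → ℕ) => outLength w) :=
  unaryPoly_card.add ((UnaryPoly.const 1).add (unaryPoly_card.mul unaryPoly_card))

theorem unaryPoly_outBit : UnaryPoly (fun w (x : Fin 1 → ℕ) => outBit w (x 0)) := by
  have h := (UnaryPoly.arg (k := 1) 0).sub unaryPoly_card.succ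
  exact (UnaryPolyPred.lt (UnaryPoly.arg 0) unaryPoly_card).ite (UnaryPoly.const 1)
    ((UnaryPolyPred.eq (UnaryPoly.arg 0) unaryPoly_card).ite (UnaryPoly.const 0)
      (unaryPolyPred_arc (h.div unaryPoly_card) (h.mod unaryPoly_card)))

theorem outBit_le (w : List Bool) (i : ℕ) : outBit w i ≤ 1 := by
  unfold outBit
  split_ifs <;> omega

theorem range_mul_map {α : Type} (a b : ℕ) (g : ℕ → α) :
    (List.range (a * b)).map g =
      (List.range a).flatMap fun u => (List.range b).map fun v => g (u * b + v) := by
  induction a with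
  | zero => simp
  | succ a ih =>
    rw [Nat.succ_mul, List.range_add, List.map_append, ih, List.range_succ, List.flatMap_append,
      List.flatMap_singleton, List.map_map]
    rfl

/-- Behind the unary prefix, the bit with index `u * n + v` is the matrix entry in row `u` and
column `v`; division with remainder by `n` recovers both. -/
theorem encode_toInstance (w : List Bool) : ((frameOf w).toInstance (good_frameOf w)).encode =
    (List.range (outLength w)).map fun i => outBit w i == 1 := by
  classical
  set n := (frameOf w).card with hn
  have h1 : (List.range n).map (fun i => outBit w i == 1) = List.replicate n true := by
    refine List.eq_replicate_iff.mpr ⟨by simp, fun b hb => ?_⟩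
    obtain ⟨i, hi, rfl⟩ := List.mem_map.mp hb
    rw [List.mem_range] at hi
    unfold outBit
    rw [if_pos hi]
    rfl
  have h2 : (outBit w n == 1) = false := by
    unfold outBit
    rw [if_neg (lt_irrefl _), if_pos rfl]
    rfl
  have h3 : ∀ u v, v < n → (outBit w (n + (1 + (u * n + v))) == 1) =
      decide ((frameOf w).Arc u v) := by
    intro u v hv
    have hdiv : (u * n + v) / n = u := by
      rw [Nat.mul_comm, Nat.mul_add_div (by omega), Nat.div_eq_of_lt hv, Nat.add_zero]
    have hmod : (u * n + v) % n = v := by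
      rw [Nat.mul_comm, Nat.mul_add_mod, Nat.mod_eq_of_lt hv]
    unfold outBit
    rw [← hn, if_neg (by omega), if_neg (by omega),
      show n + (1 + (u * n + v)) - (n + 1) = u * n + v by omega, hdiv, hmod]
    by_cases harc : (frameOf w).Arc u v <;> simp [harc]
  have h4 : (List.range (n * n)).map (fun i => outBit w (n + (1 + i)) == 1) =
      (List.finRange n).flatMap fun u => (List.finRange n).map fun v =>
        decide ((frameOf w).Arc u.1 v.1) := by
    rw [range_mul_map, ← List.map_coe_finRange_eq_range, List.flatMap_map]
    refine List.flatMap_congr fun u _ => ?_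
    rw [List.map_map]
    exact List.map_congr_left fun v _ => h3 u v v.2
  unfold outLength
  rw [List.range_add, List.range_add, List.map_append, List.map_map, List.map_append,
    List.map_map, ← hn, h1]
  unfold DigraphInstance.encode unary
  rw [List.append_assoc]
  congr 1
  refine (congrArg₂ _ ?_ h4).symm
  simpa using h2

end DiColoring

namespace DiColoring

/-! ### Size of the reduction -/

/-- The bound on the treedepth of the digraph of a formula of size `N`. -/
def tdBound (N : ℕ) : ℕ :=
  2 ^ (Nat.log 2 N / 2 + 1) + 2 + (N / (Nat.log 2 N / 2 + 1) + 1) + 6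

/-- This expresses td log td = O(N), with `q` the group size. For h = ⌊log N⌋ / 2 the bound is 2 · 2
^ h + N / (h + 1) + 9. Multiplied by h + 1 ≤ 2 ^ h, its terms are at most 2N, N and 9N, because 2 ^
h · 2 ^ h ≤ N. Moreover 12N ≤ 2 ^ 4 · 2 ^ (2(h + 1)). -/
theorem tdBound_le (N : ℕ) (hN : 1 ≤ N) :
    ∃ q : ℕ, tdBound N * q ≤ 12 * N ∧ tdBound N ≤ 2 ^ (6 * q) := by
  set h := Nat.log 2 N / 2 with hh
  have h4 : 2 ^ h * 2 ^ h ≤ N := by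
    rw [← pow_add]
    exact (Nat.pow_le_pow_right (by omega) (by omega)).trans (Nat.pow_log_le_self 2 (by omega))
  have hN4 : N < 2 ^ (2 * (h + 1)) :=
    (Nat.lt_pow_succ_log_self (by omega) N).trans_le (Nat.pow_le_pow_right (by omega) (by omega))
  have hh1 : h + 1 ≤ 2 ^ h := Nat.lt_two_pow_self
  have hdiv : N / (h + 1) * (h + 1) ≤ N := Nat.div_mul_le_self _ _
  have hdiv' : N / (h + 1) ≤ N := Nat.div_le_self _ _
  have hK : tdBound N = 2 * 2 ^ h + N / (h + 1) + 9 := by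
    unfold tdBound
    rw [← hh, pow_succ]
    omega
  have hle : 2 ^ h ≤ N := le_trans (Nat.le_mul_of_pos_left _ (by positivity)) h4
  refine ⟨h + 1, ?_, ?_⟩
  · rw [hK]
    nlinarith
  · have h12 : tdBound N ≤ 12 * N := by omega
    refine h12.trans ?_
    have h16 : 2 ^ (6 * (h + 1)) = 2 ^ (2 * (h + 1)) * 2 ^ (4 * (h + 1)) := by
      rw [← pow_add]; congr 1; omega
    have h17 : 2 ^ 4 ≤ 2 ^ (4 * (h + 1)) := Nat.pow_le_pow_right (by omega) (by omega)
    rw [h16, Nat.mul_comm 12 N]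
    exact Nat.mul_le_mul hN4.le (le_trans (by norm_num) h17)

theorem length_encode_le (φ : ThreeCNF) :
    φ.encode.length ≤ (φ.numVars + φ.numClauses + 4) ^ 3 := by
  -- At most `4` bits for the length of the clause and `numVars + 1` bits for each of at most three
  -- literals.
  have h1 : ∀ c ∈ φ.clauses, (Scan.clauseCode c).length ≤ 7 + 3 * φ.numVars := by
    intro c hc
    have h2 : (c.flatMap Scan.litCode).length ≤ c.length * (φ.numVars + 1) := by
      rw [List.length_flatMap]
      refine (List.sum_le_card_nsmul _ (φ.numVars + 1) ?_).trans (by simp)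
      intro x hx
      obtain ⟨l, _, rfl⟩ := List.mem_map.mp hx
      have := l.1.2
      simp only [Scan.litCode, List.length_cons, Scan.length_unary]
      omega
    have h3 := φ.length_le c hc
    have h4 : c.length * (φ.numVars + 1) ≤ 3 * (φ.numVars + 1) := Nat.mul_le_mul_right _ h3
    rw [Scan.clauseCode, List.length_append, Scan.length_unary]
    omega
  have h2 : (φ.clauses.flatMap Scan.clauseCode).length ≤ φ.numClauses * (7 + 3 * φ.numVars) := by
    rw [List.length_flatMap]
    refine (List.sum_le_card_nsmul _ (7 + 3 * φ.numVars) ?_).trans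
      (by simp [ThreeCNF.numClauses])
    intro x hx
    obtain ⟨c, hc, rfl⟩ := List.mem_map.mp hx
    exact h1 c hc
  rw [Scan.encode_eq, List.length_append, List.length_append, Scan.length_unary,
    Scan.length_unary]
  have key : ∀ n m z : ℕ, z ≤ m * (7 + 3 * n) → n + 1 + (m + 1 + z) ≤ (n + m + 4) ^ 3 := by
    intro n m z hz
    have h3 : (n + m + 4) ^ 3 = (n + m) ^ 3 + 12 * (n + m) ^ 2 + 48 * (n + m) + 64 := by ring
    have h4 : m * (7 + 3 * n) ≤ 12 * (n + m) ^ 2 + 7 * (n + m) := by nlinarith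
    have h5 := Nat.zero_le ((n + m) ^ 3)
    omega
  exact key _ _ _ h2

theorem card_frameOf_le (w : List Bool) :
    (frameOf w).card ≤ (Scan.numVars w + Scan.numClauses w + 4) ^ 7 := by
  set N := Scan.numVars w + Scan.numClauses w with hN
  have hL : (frameOf w).L ≤ 2 * (N + 1) := two_pow_log_div_two_le N
  have hG : (frameOf w).G ≤ N + 1 := Nat.succ_le_succ (Nat.div_le_self _ _)
  have hm : (frameOf w).m ≤ N := Nat.le_add_left _ _
  have h1 : (frameOf w).L * (frameOf w).L * (frameOf w).L ≤
      2 * (N + 1) * (2 * (N + 1)) * (2 * (N + 1)) :=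
    Nat.mul_le_mul (Nat.mul_le_mul hL hL) hL
  have h2 := Nat.mul_le_mul hm h1
  have h3 : 4 ^ 3 * (N + 4) ^ 4 ≤ (N + 4) ^ 3 * (N + 4) ^ 4 :=
    Nat.mul_le_mul_right _ (Nat.pow_le_pow_left (by omega) 3)
  have h4 : (N + 4) ^ 7 = (N + 4) ^ 3 * (N + 4) ^ 4 := by ring
  have h5 : N * (2 * (N + 1) * (2 * (N + 1)) * (2 * (N + 1))) * 6 + (3 * N + 5) ≤
      4 ^ 3 * (N + 4) ^ 4 := by
    have e1 : N * (2 * (N + 1) * (2 * (N + 1)) * (2 * (N + 1))) * 6 + (3 * N + 5) =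
      48 * N ^ 4 + 144 * N ^ 3 + 144 * N ^ 2 + 51 * N + 5 := by ring
    have e2 : 4 ^ 3 * (N + 4) ^ 4 =
      64 * N ^ 4 + 1024 * N ^ 3 + 6144 * N ^ 2 + 16384 * N + 16384 := by ring
    omega
  unfold Frame.card Frame.S Frame.gadgets
  omega

theorem outLength_le (w : List Bool) :
    outLength w ≤ (Scan.numVars w + Scan.numClauses w + 4) ^ 16 := by
  have h := card_frameOf_le w
  have ha : 4 ≤ Scan.numVars w + Scan.numClauses w + 4 := Nat.le_add_left _ _
  unfold outLength
  generalize Scan.numVars w + Scan.numClauses w + 4 = a at h ha ⊢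
  generalize (frameOf w).card = n at h ⊢
  have h1 : n * n ≤ a ^ 7 * a ^ 7 := Nat.mul_le_mul h h
  have h2 : a ^ 16 = a ^ 7 * a ^ 7 * (a * a) := by ring
  have h3 : 1 ≤ a ^ 7 := Nat.one_le_pow _ _ (by omega)
  have h4 : 4 * 4 ≤ a * a := Nat.mul_le_mul ha ha
  have h5 : a ^ 7 * a ^ 7 * (4 * 4) ≤ a ^ 7 * a ^ 7 * (a * a) := Nat.mul_le_mul_left _ h4
  have h6 : a ^ 7 * 1 ≤ a ^ 7 * a ^ 7 := Nat.mul_le_mul_left _ h3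
  omega

/-! ### Asymptotics -/

theorem DecidableWithin.mono {α : Type} {enc : α → List Bool} {P : α → Prop} {T T' : α → ℝ}
    (h : DecidableWithin enc P T) (hT : ∀ a, T a ≤ T' a) : DecidableWithin enc P T' := by
  obtain ⟨M, hM⟩ := h
  refine ⟨M, fun a => ?_⟩
  obtain ⟨t, ht, h⟩ := hM a
  exact ⟨t, ht.trans (hT a), h⟩

/-- The exponent of the running time on digraphs of treedepth at most `tdBound N`. -/
noncomputable def maxExponent (f : ℕ → ℝ) (N : ℕ) : ℝ :=
  (Finset.range (tdBound N + 1)).sup' Finset.nonempty_range_add_one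
    fun t => |f t| * Real.logb 2 t

theorem maxExponent_nonneg (f : ℕ → ℝ) (N : ℕ) : 0 ≤ maxExponent f N := by
  have h0 : |f 0| * Real.logb 2 (0 : ℕ) ≤ maxExponent f N :=
    Finset.le_sup' (fun t : ℕ => |f t| * Real.logb 2 t) (Finset.mem_range.mpr (by omega))
  rwa [Nat.cast_zero, Real.logb_zero, mul_zero] at h0

/-- The treedepth is known only up to an upper bound, and `f` may be negative or far from monotone.
Hence the maximum of `|f t| * log t` over all admissible `t`. -/
theorem rpow_le_two_rpow_maxExponent (f : ℕ → ℝ) {N t : ℕ} (ht : t ≤ tdBound N) :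
    (t : ℝ) ^ f t ≤ 2 ^ maxExponent f N := by
  have h1 : |f t| * Real.logb 2 t ≤ maxExponent f N :=
    Finset.le_sup' (fun t : ℕ => |f t| * Real.logb 2 t) (Finset.mem_range.mpr (by omega))
  rcases Nat.eq_zero_or_pos t with rfl | hpos
  · rw [Nat.cast_zero]
    exact (Real.zero_rpow_le_one _).trans
      (Real.one_le_rpow one_le_two (maxExponent_nonneg f N))
  · have ht1 : (1 : ℝ) ≤ t := by exact_mod_cast hpos
    calc (t : ℝ) ^ f t ≤ (t : ℝ) ^ |f t| := Real.rpow_le_rpow_of_exponent_le ht1 (le_abs_self _)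
      _ = (2 ^ Real.logb 2 t) ^ |f t| := by
        rw [Real.rpow_logb (by norm_num) (by norm_num) (by linarith)]
      _ = 2 ^ (|f t| * Real.logb 2 t) := by rw [← Real.rpow_mul (by norm_num), mul_comm]
      _ ≤ 2 ^ maxExponent f N := Real.rpow_le_rpow_of_exponent_le one_le_two h1

/-- For large `t` the factor `|f t|` is a small multiple of `t`, and t log t = O(N) by `tdBound_le`.
The finitely many small `t` contribute a constant. -/
theorem isLittleO_maxExponent {f : ℕ → ℝ} (hf : f =o[atTop] (fun k : ℕ => (k : ℝ))) :
    maxExponent f =o[atTop] (fun k : ℕ => (k : ℝ)) := by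
  rw [isLittleO_iff]
  intro ε hε
  -- With the factors `6` and `12` from `tdBound_le`, the choice `ε / 144` yields `ε / 2 * N`.
  have h1 := isLittleO_iff.mp hf (show (0 : ℝ) < ε / 144 by positivity)
  obtain ⟨t₀, ht₀⟩ := eventually_atTop.mp h1
  set A : ℝ := ∑ t ∈ Finset.range t₀, |f t| * |Real.logb 2 t| with hA
  have hA0 : 0 ≤ A := Finset.sum_nonneg fun t _ => by positivity
  obtain ⟨N₀, hN₀⟩ := exists_nat_ge (A / (ε / 2))
  filter_upwards [eventually_ge_atTop (max N₀ 1)] with N hN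
  have hN1 : 1 ≤ N := le_trans (le_max_right _ _) hN
  have hNA : A ≤ ε / 2 * N := by
    have h2 : (N₀ : ℝ) ≤ N := by exact_mod_cast le_trans (le_max_left _ _) hN
    have h3 := hN₀.trans h2
    rwa [div_le_iff₀ (by positivity), mul_comm] at h3
  rw [Real.norm_of_nonneg (maxExponent_nonneg f N), Real.norm_of_nonneg (by positivity)]
  refine Finset.sup'_le _ _ fun t ht => ?_
  rw [Finset.mem_range] at ht
  obtain ⟨q, hq, hq'⟩ := tdBound_le N hN1
  rcases Nat.lt_or_ge t t₀ with hlt | hge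
  · have h2 : |f t| * |Real.logb 2 t| ≤ A :=
      Finset.single_le_sum (f := fun t : ℕ => |f t| * |Real.logb 2 t|)
        (fun t _ => by positivity) (Finset.mem_range.mpr hlt)
    have h3 : |f t| * Real.logb 2 t ≤ |f t| * |Real.logb 2 t| :=
      mul_le_mul_of_nonneg_left (le_abs_self _) (abs_nonneg _)
    have h4 : 0 ≤ ε / 2 * N := by positivity
    linarith
  · have h2 := ht₀ t hge
    rw [Real.norm_eq_abs, Real.norm_of_nonneg (by positivity)] at h2
    have h3 : Real.logb 2 t ≤ 6 * q := by
      rcases Nat.eq_zero_or_pos t with rfl | hpos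
      · rw [Nat.cast_zero, Real.logb_zero]
        positivity
      · rw [Real.logb_le_iff_le_rpow (by norm_num) (by exact_mod_cast hpos)]
        have h4 : t ≤ 2 ^ (6 * q) := by omega
        have h5 : ((2 : ℝ) ^ ((6 : ℝ) * q)) = ((2 ^ (6 * q) : ℕ) : ℝ) := by
          rw [show ((6 : ℝ) * q) = ((6 * q : ℕ) : ℝ) by push_cast; ring, Real.rpow_natCast]
          push_cast
          rfl
        rw [h5]
        exact_mod_cast h4
    have h4 : (t : ℝ) * q ≤ 12 * N := by
      have : t * q ≤ 12 * N := le_trans (Nat.mul_le_mul_right _ (by omega)) hq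
      exact_mod_cast this
    calc |f t| * Real.logb 2 t ≤ |f t| * (6 * q) := mul_le_mul_of_nonneg_left h3 (abs_nonneg _)
      _ ≤ ε / 144 * t * (6 * q) := mul_le_mul_of_nonneg_right h2 (by positivity)
      _ = ε / 24 * (t * q) := by ring
      _ ≤ ε / 24 * (12 * N) := mul_le_mul_of_nonneg_left h4 (by positivity)
      _ ≤ ε * N := by
        have : 0 ≤ ε * N := by positivity
        linarith

theorem isLittleO_logb_add (a : ℕ) :
    (fun N : ℕ => Real.logb 2 (N + a)) =o[atTop] (fun k : ℕ => (k : ℝ)) := by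
  have h1 : (fun N : ℕ => Real.log ((N : ℝ) + a)) =o[atTop] (fun N : ℕ => (N : ℝ) + a) :=
    Real.isLittleO_log_id_atTop.comp_tendsto
      (tendsto_atTop_add_const_right _ _ tendsto_natCast_atTop_atTop)
  have h2 : (fun N : ℕ => (N : ℝ) + a) =O[atTop] (fun N : ℕ => (N : ℝ)) := by
    refine (isBigO_refl _ _).add ?_
    exact (isLittleO_const_left.mpr (Or.inr (by
      simpa [Function.comp_def] using tendsto_natCast_atTop_atTop))).isBigO
  simp only [Real.logb, div_eq_inv_mul]
  exact (h1.trans_isBigO h2).const_mul_left _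

/-- The exponents `4 * a` and `16` bound the running time of the program and the length of its
output; the further `2` absorbs the sum into a product. -/
theorem pow_add_pow_le {N w l a : ℕ} (hw : w ≤ (N + 4) ^ 3) (hl : l ≤ (N + 4) ^ 16) :
    (w + 2) ^ a + (l + 1) ≤ (N + 4) ^ (4 * a + 18) := by
  have hb : w + 2 ≤ (N + 4) ^ 4 := by
    have h2 : (N + 4) ^ 4 = (N + 4) ^ 3 * (N + 4) := pow_succ _ _
    have h3 : 4 ^ 3 ≤ (N + 4) ^ 3 := Nat.pow_le_pow_left (by omega) 3
    have h4 : (N + 4) ^ 3 * 4 ≤ (N + 4) ^ 3 * (N + 4) := Nat.mul_le_mul_left _ (by omega)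
    omega
  have hx : (w + 2) ^ a ≤ (N + 4) ^ (4 * a) := by
    rw [pow_mul]
    exact Nat.pow_le_pow_left hb a
  have hx1 : 1 ≤ (N + 4) ^ (4 * a) := Nat.one_le_pow _ _ (by omega)
  have hy1 : 1 ≤ (N + 4) ^ 16 := Nat.one_le_pow _ _ (by omega)
  have h4 : (N + 4) ^ (4 * a + 18) = (N + 4) ^ (4 * a) * (N + 4) ^ 16 * ((N + 4) * (N + 4)) := by
    ring
  have h5 : 4 * 4 ≤ (N + 4) * (N + 4) := Nat.mul_le_mul (by omega) (by omega)
  rw [h4]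
  generalize (N + 4) ^ (4 * a) = x at hx hx1 ⊢
  generalize (N + 4) ^ 16 = y at hl hy1 ⊢
  have h1 : x * 1 ≤ x * y := Nat.mul_le_mul_left _ hy1
  have h2 : 1 * y ≤ x * y := Nat.mul_le_mul_right _ hx1
  have h6 := Nat.mul_le_mul_left (x * y) h5
  omega

/-- The sum is bounded by a product of the polynomial factor, the constant and `2 ^ M`, whose
logarithms add up to the exponent. The constant is `1 + |C|` because `C` may be zero or negative and
the term `X` must be covered as well. -/
theorem time_le_two_rpow {C X Y d v M : ℝ} {b c N : ℕ} (hX : X ≤ ((N : ℝ) + 4) ^ b)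
    (hY : Y = C * d * v ^ c) (hv0 : 0 ≤ v) (hv : v ≤ ((N : ℝ) + 4) ^ 7) (hd0 : 0 ≤ d)
    (hd : d ≤ 2 ^ M) (hM : 0 ≤ M) :
    X + Y ≤ 2 ^ (((b + 7 * c : ℕ) : ℝ) * Real.logb 2 (N + (4 : ℕ)) +
      Real.logb 2 (1 + |C|) + M) := by
  have hx0 : (0 : ℝ) < (N : ℝ) + 4 := by positivity
  have hx1 : (1 : ℝ) ≤ (N : ℝ) + 4 := by
    have : (0 : ℝ) ≤ N := Nat.cast_nonneg N
    linarith
  have hC : 0 < 1 + |C| := by positivity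
  have hgoal : (2 : ℝ) ^ (((b + 7 * c : ℕ) : ℝ) * Real.logb 2 (N + (4 : ℕ)) +
      Real.logb 2 (1 + |C|) + M) = ((N : ℝ) + 4) ^ (b + 7 * c) * (1 + |C|) * 2 ^ M := by
    rw [Nat.cast_ofNat, Real.rpow_add (by norm_num), Real.rpow_add (by norm_num),
      Real.rpow_logb (by norm_num) (by norm_num) hC, mul_comm ((_ : ℕ) : ℝ),
      Real.rpow_mul (by norm_num), Real.rpow_logb (by norm_num) (by norm_num) hx0,
      Real.rpow_natCast]
  have hX' : X ≤ ((N : ℝ) + 4) ^ (b + 7 * c) :=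
    hX.trans (pow_le_pow_right₀ hx1 (Nat.le_add_right _ _))
  have hv' : v ^ c ≤ ((N : ℝ) + 4) ^ (b + 7 * c) := by
    refine (pow_le_pow_left₀ hv0 hv c).trans ?_
    rw [← pow_mul]
    exact pow_le_pow_right₀ hx1 (Nat.le_add_left _ _)
  have hM1 : (1 : ℝ) ≤ 2 ^ M := Real.one_le_rpow one_le_two hM
  have hZ0 : 0 ≤ ((N : ℝ) + 4) ^ (b + 7 * c) := pow_nonneg hx0.le _
  have hvc : 0 ≤ v ^ c := pow_nonneg hv0 c
  rw [hgoal, hY]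
  generalize ((N : ℝ) + 4) ^ (b + 7 * c) = Z at *
  generalize (2 : ℝ) ^ M = W at *
  have hB : C * d * v ^ c ≤ |C| * W * Z := by
    refine mul_le_mul ?_ hv' hvc (by positivity)
    exact mul_le_mul (le_abs_self C) hd hd0 (abs_nonneg C)
  have h1 : Z ≤ Z * W := le_mul_of_one_le_right hZ0 hM1
  calc X + C * d * v ^ c ≤ Z * W + |C| * W * Z := add_le_add (hX'.trans h1) hB
    _ = Z * (1 + |C|) * W := by ring

/-- The digraph of a formula. -/
noncomputable def reduction (φ : ThreeCNF) : DigraphInstance :=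
  (frameOf φ.encode).toInstance (good_frameOf _)

theorem td_reduction_le (φ : ThreeCNF) :
    (reduction φ).td ≤ tdBound (φ.numVars + φ.numClauses) := by
  have hN : Scan.numVars φ.encode + Scan.numClauses φ.encode = φ.numVars + φ.numClauses := by
    rw [Scan.numVars_encode, Scan.numClauses_encode]
  refine (Frame.treedepth_graph_le (good_frameOf φ.encode)).trans (le_of_eq ?_)
  simp only [Frame.S, frameOf, tdBound, hN]

theorem n_reduction_le (φ : ThreeCNF) :
    (reduction φ).n ≤ (φ.numVars + φ.numClauses + 4) ^ 7 := by
  have h := card_frameOf_le φ.encode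
  rwa [Scan.numVars_encode, Scan.numClauses_encode] at h

theorem encode_reduction (φ : ThreeCNF) :
    (reduction φ).encode = (List.range (outLength φ.encode)).map
      fun i => outBit φ.encode i == 1 :=
  encode_toInstance _

theorem length_encode_reduction_le (φ : ThreeCNF) :
    (reduction φ).encode.length ≤ (φ.numVars + φ.numClauses + 4) ^ 16 := by
  have h := outLength_le φ.encode
  rw [Scan.numVars_encode, Scan.numClauses_encode] at h
  rwa [encode_reduction, List.length_map, List.length_range]

theorem isColorable_reduction (φ : ThreeCNF) :
    φ.Satisfiable ↔ IsColorable (reduction φ).graph 2 :=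
  (sat_frameOf φ).symm.trans (Frame.isColorable_iff (good_frameOf _)).symm

theorem not_eth_of_decidableWithin {f : ℕ → ℝ} (hf : f =o[atTop] (fun k : ℕ => (k : ℝ)))
    {C : ℝ} {c : ℕ} (hdec : DecidableWithin DigraphInstance.encode
      (fun D => IsColorable D.graph 2)
      (fun D => C * (D.td : ℝ) ^ f D.td * (D.n : ℝ) ^ c)) : ¬ ETH := by
  obtain ⟨P, a, hP⟩ := exists_exec_of_unaryPoly unaryPoly_outLength unaryPoly_outBit outBit_le
  have hred := StackProg.decidableWithin_of_exec (Q := ThreeCNF.Satisfiable)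
    (enc := ThreeCNF.encode) reduction isColorable_reduction P
    (fun φ => (φ.encode.length + 2) ^ a) (fun φ => by rw [encode_reduction]; exact hP _) hdec
  -- The exponent collects the polynomial factors (`4 * a + 18` from the reduction, `7 * c` from `n
  -- ^ c` with `n ≤ (N + 4) ^ 7`), the constant factor, and the power of the treedepth.
  refine not_not_intro ⟨fun N => ((4 * a + 18 + 7 * c : ℕ) : ℝ) * Real.logb 2 (N + (4 : ℕ)) +
    Real.logb 2 (1 + |C|) + maxExponent f N, ?_, hred.mono fun φ => ?_⟩
  · refine (((isLittleO_logb_add 4).const_mul_left _).add ?_).add (isLittleO_maxExponent hf)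
    exact isLittleO_const_left.mpr (Or.inr (by
      simpa [Function.comp_def] using tendsto_natCast_atTop_atTop))
  · refine time_le_two_rpow ?_ rfl (Nat.cast_nonneg _) ?_ (Real.rpow_nonneg (Nat.cast_nonneg _) _)
      (rpow_le_two_rpow_maxExponent f (td_reduction_le φ)) (maxExponent_nonneg _ _)
    · have hA := pow_add_pow_le (a := a) (length_encode_le φ) (length_encode_reduction_le φ)
      have hA' := (Nat.cast_le (α := ℝ)).mpr hA
      push_cast at hA' ⊢
      exact hA'
    · have hn := (Nat.cast_le (α := ℝ)).mpr (n_reduction_le φ)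
      push_cast at hn ⊢
      exact hn

end DiColoring

theorem mainTheorem1
    (h : ∃ f : ℕ → ℝ, f =o[atTop] (fun k : ℕ => (k : ℝ)) ∧ ∃ (C : ℝ) (c : ℕ),
      DiColoring.DecidableWithin DiColoring.DigraphInstance.encode
        (fun D => DiColoring.IsColorable D.graph 2)
        (fun D => C * (D.td : ℝ) ^ f D.td * (D.n : ℝ) ^ c)) :
    ¬ DiColoring.ETH := by
  obtain ⟨f, hf, C, c, hdec⟩ := h
  exact DiColoring.not_eth_of_decidableWithin hf hdec
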